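/- Let $a\in C([0,1])\cap C^1((0,1])$ satisfy $a(0)=0$, $a(x)>0$ for $x\in(0,1]$, $\mu_a:=\sup_{0<x\le 1}\frac{x|a'(x)|}{a(x)}<2$ and $a\in C^{[\mu_a]}([0,1])$, where $[\cdot]$ is the integer part. Let $V^1_a(0,1)$ be the space of all $w\in L^2(0,1)$ that are locally absolutely continuous in $(0,1]$ and satisfy $\sqrt a\,w'\in L^2(0,1)$. Let $H^1_a(0,1)$ be the space of all $w\in V^1_a(0,1)$ with $w(1)=0$ and, if $\mu_a<1$, also $w(0)=0$, and let $H^2_a(0,1)=\{w\in H^1_a(0,1): aw'\in H^1(0,1)\}$. On $\mathcal H_0=H^1_a(0,1)\times L^2(0,1)$, with norm $\|(w,v)\|^2=\int_0^1(v^2+a\,(w')^2)\,dx$, consider the operator $A(w,v)=(v,(aw')')$ with domain $D(A)=H^2_a(0,1)\times H^1_a(0,1)$. A mild solution $u$ of the degenerate wave equation $$u_{tt}-(a(x)u_x)_x=0\quad\text{in }(0,\infty)\times(0,1)$$ (with $u(t,1)=0$, and with $u(t,0)=0$ if $\mu_a<1$, $\lim_{x\downarrow0}a(x)u_x(t,x)=0$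 if $\mu_a\ge1$) is the first component of a mild solution $U=(u,u_t)\in C([0,\infty);\mathcal H_0)$ of $U'=AU$, that is, $\int_0^tU(s)\,ds\in D(A)$ and $U(t)=U(0)+A\int_0^tU(s)\,ds$ for all $t\ge0$ (equivalently, $U(t)=e^{tA}U(0)$). It is classical if $U(t)\in D(A)$ for all $t\ge 0$ and $U\in C^1([0,\infty);\mathcal H_0)$ with $U'=AU$. Its energy is $E_u(t)=\frac12\int_0^1\big(u_t(t,x)^2+a(x)u_x(t,x)^2\big)\,dx$. The normal derivative $u_x(\cdot,1)$ of a mild solution is the limit in $L^2(0,T)$, for every $T\ge 0$, of the functions $u^n_x(\cdot,1)$ for any sequence of classical solutions $u^n$ whose initial data converge in $\mathcal H_0$ to those of $u$. Then, for every mild solution $u$, the normal derivative $u_x(\cdot,1)$ is well defined in this sense (approximating sequences exist, and the limits exist and do not depend on the sequence), and for every $T\ge0$ one has $u_x(\cdot,1)\in L^2(0,T)$, $$a(1)\int_0^Tu_x(t,1)^2\,dt\le\Big(6T+\frac{4}{\min\{1,a(1)\}}\Big)E_u(0),$$ and $$a(1)\int_0^Tu_x(t,1)^2\,dt=\int_0^T\!\!\int_0^1\Big\{u_t(t,x)^2+\big(a(x)-x\,a'(x)\big)u_x(t,x)^2\Big\}\,dx\,dt+2\Big[\int_0^1x\,u_x(t,x)\,u_t(t,x)\,dx\Big]_{t=0}^{t=T}.$$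 -/

import Mathlib

open MeasureTheory Set Filter Topology

noncomputable section

namespace DegenerateWave

/-- Lebesgue measure on the interval `(0,1)`. -/
abbrev unitMeasure : Measure ℝ := volume.restrict (Ioo (0 : ℝ) 1)

/-- The Hilbert space `L²(0,1)`. -/
abbrev L2 : Type := Lp ℝ 2 unitMeasure

open scoped Classical in
/-- The class in `L²(0,1)` of a function on the real line whose restriction to `(0,1)` is square
integrable. (The value `0` for other functions is never used: membership in `L²` is required
separately wherever this map is applied.) -/
def toL2 (f : ℝ → ℝ) : L2 := if hf : MemLp f 2 unitMeasure then hf.toLp f else 0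

/-- The derivative of the coefficient, as a function on `[0,1]` (one-sided at `1`). -/
def coeffDeriv (a : ℝ → ℝ) (x : ℝ) : ℝ := derivWithin a (Icc 0 1) x

/-- The degeneracy parameter `μ_a = sup_{0 < x ≤ 1} x |a'(x)| / a(x)`. -/
def mu (a : ℝ → ℝ) : ℝ := sSup ((fun x => x * |coeffDeriv a x| / a x) '' Ioc 0 1)

/-- The standing assumptions on the coefficient `a`: it lies in `C([0,1]) ∩ C¹((0,1])`, is positive
on `(0,1]`, vanishes at `0`, satisfies `μ_a < 2` (with a finite supremum), and lies in
`C^[μ_a]([0,1])`, where `[·]` is the integer part. -/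
structure IsCoefficient (a : ℝ → ℝ) : Prop where
  continuousOn : ContinuousOn a (Icc 0 1)
  contDiffOn : ContDiffOn ℝ 1 a (Ioc 0 1)
  pos : ∀ x ∈ Ioc (0 : ℝ) 1, 0 < a x
  zero : a 0 = 0
  bddAbove : BddAbove ((fun x => x * |coeffDeriv a x| / a x) '' Ioc 0 1)
  mu_lt_two : mu a < 2
  contDiffOn_floor : ContDiffOn ℝ (⌊mu a⌋₊ : ℕ) a (Icc 0 1)

/-- The function `√a w'`. -/
def weightedDeriv (a w : ℝ → ℝ) (x : ℝ) : ℝ := √(a x) * deriv w x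

/-- The function `(a w')'`. -/
def degenOp (a w : ℝ → ℝ) (x : ℝ) : ℝ := deriv (fun y => a y * deriv w y) x

/-- The space `V¹_a(0,1)`: functions in `L²(0,1)` that are locally absolutely continuous in `(0,1]`
and satisfy `√a w' ∈ L²(0,1)`. -/
structure MemV1 (a w : ℝ → ℝ) : Prop where
  memLp : MemLp w 2 unitMeasure
  locallyAC : ∀ ε ∈ Ioo (0 : ℝ) 1, AbsolutelyContinuousOnInterval w ε 1
  memLp_weightedDeriv : MemLp (weightedDeriv a w) 2 unitMeasure

/-- The space `H¹_a(0,1)`: functions `w ∈ V¹_a(0,1)` with `w(1) = 0` and, in the weakly degenerate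
case `μ_a < 1`, also `w(0) = 0` (as the limit of `w` at `0`). -/
structure MemH1 (a w : ℝ → ℝ) : Prop extends MemV1 a w where
  at_one : w 1 = 0
  at_zero : mu a < 1 → Tendsto w (𝓝[>] 0) (𝓝 0)

/-- The space `V²_a(0,1)`: functions `w ∈ V¹_a(0,1)` such that `a w' ∈ H¹(0,1)`, that is, `a w'`
agrees almost everywhere with an absolutely continuous function `p` on `[0,1]` with
`p' ∈ L²(0,1)`. -/
structure MemV2 (a w : ℝ → ℝ) : Prop extends MemV1 a w where
  flux : ∃ p : ℝ → ℝ, AbsolutelyContinuousOnInterval p 0 1 ∧ MemLp (deriv p) 2 unitMeasure ∧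
    (fun x => a x * deriv w x) =ᵐ[unitMeasure] p

/-- The space `H²_a(0,1) = V²_a(0,1) ∩ H¹_a(0,1)`. -/
def MemH2 (a w : ℝ → ℝ) : Prop := MemV2 a w ∧ MemH1 a w

/-- The graph of the wave operator `A(u,v) = (v, (a u')')` with domain
`D(A) = H²_a(0,1) × H¹_a(0,1)`: `(u,v) ∈ D(A)` and `A(u,v) = (f,g)`. -/
structure WaveOp (a u v f g : ℝ → ℝ) : Prop where
  mem_left : MemH2 a u
  mem_right : MemH1 a v
  eq_left : f =ᵐ[unitMeasure] v
  eq_right : g =ᵐ[unitMeasure] degenOp a u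

/-- `(u, ut)` is a mild solution of the Cauchy problem `U' = A U`, `t ≥ 0`, in the energy space
`H¹_a(0,1) × L²(0,1)`: it is a continuous curve in the energy space, and for all `t ≥ 0` one has
`∫₀ᵗ U(s) ds ∈ D(A)` and `U(t) = U(0) + A ∫₀ᵗ U(s) ds`. Here `u t` and `ut t` are the functions
`u(t,·)` and `u_t(t,·)`; the functions `w` and `z` below represent the components
`∫₀ᵗ u(s) ds` and `∫₀ᵗ u_t(s) ds` (Bochner integrals) of `∫₀ᵗ U(s) ds`. -/
structure IsMildSolution (a : ℝ → ℝ) (u ut : ℝ → ℝ → ℝ) : Prop where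
  mem_left : ∀ t, 0 ≤ t → MemH1 a (u t)
  mem_right : ∀ t, 0 ≤ t → MemLp (ut t) 2 unitMeasure
  continuousOn_u : ContinuousOn (fun t => toL2 (u t)) (Ici 0)
  continuousOn_ux : ContinuousOn (fun t => toL2 (weightedDeriv a (u t))) (Ici 0)
  continuousOn_ut : ContinuousOn (fun t => toL2 (ut t)) (Ici 0)
  integrated : ∀ t, 0 ≤ t → ∃ w z : ℝ → ℝ,
    toL2 w = ∫ s in (0 : ℝ)..t, toL2 (u s) ∧
    toL2 z = ∫ s in (0 : ℝ)..t, toL2 (ut s) ∧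
    WaveOp a w z (fun x => u t x - u 0 x) (fun x => ut t x - ut 0 x)

/-- `(u, ut)` is a classical solution: `U(t) ∈ D(A)` for all `t ≥ 0`, and `U` is continuously
differentiable in the energy space with `U' = A U`, so that `U` is also continuous with values in
`D(A)` (with the graph norm). -/
structure IsClassicalSolution (a : ℝ → ℝ) (u ut : ℝ → ℝ → ℝ) : Prop where
  mem_left : ∀ t, 0 ≤ t → MemH2 a (u t)
  mem_right : ∀ t, 0 ≤ t → MemH1 a (ut t)
  deriv_u : ∀ t, 0 ≤ t →
    HasDerivWithinAt (fun s => toL2 (u s)) (toL2 (ut t)) (Ici 0) t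
  deriv_ux : ∀ t, 0 ≤ t → HasDerivWithinAt (fun s => toL2 (weightedDeriv a (u s)))
    (toL2 (weightedDeriv a (ut t))) (Ici 0) t
  deriv_ut : ∀ t, 0 ≤ t →
    HasDerivWithinAt (fun s => toL2 (ut s)) (toL2 (degenOp a (u t))) (Ici 0) t
  continuousOn_utx : ContinuousOn (fun t => toL2 (weightedDeriv a (ut t))) (Ici 0)
  continuousOn_utt : ContinuousOn (fun t => toL2 (degenOp a (u t))) (Ici 0)

/-- A sequence of classical solutions whose initial data converge, in the norm
`(∫₀¹ (v² + a (u')²))^(1/2)` of the energy space, to the initial data of `(u, ut)`. -/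
structure IsClassicalApproximation (a : ℝ → ℝ) (un utn : ℕ → ℝ → ℝ → ℝ) (u ut : ℝ → ℝ → ℝ) :
    Prop where
  classical : ∀ n, IsClassicalSolution a (un n) (utn n)
  tendsto_ux : Tendsto (fun n => toL2 (weightedDeriv a (un n 0))) atTop
    (𝓝 (toL2 (weightedDeriv a (u 0))))
  tendsto_ut : Tendsto (fun n => toL2 (utn n 0)) atTop (𝓝 (toL2 (ut 0)))

/-- `γ` is (a version of) the normal derivative `u_x(·,1)` of the solution `(u, ut)`, defined by
density: `u_x(t,1)` is the one-sided derivative for classical solutions, and in general `γ` is the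
limit in `L²(0,T)`, for every `T`, of the normal derivatives of the classical solutions whose
initial data converge to those of `(u, ut)`. Such sequences have to exist, so `γ` is unique up to
null sets; constant sequences show that `γ(t) = u_x(t,1)` for almost every `t` if `(u, ut)` is
itself classical. -/
structure IsNormalDerivative (a : ℝ → ℝ) (u ut : ℝ → ℝ → ℝ) (γ : ℝ → ℝ) : Prop where
  aestronglyMeasurable : AEStronglyMeasurable γ (volume.restrict (Ioi 0))
  exists_approximation : ∃ un utn : ℕ → ℝ → ℝ → ℝ, IsClassicalApproximation a un utn u ut
  tendsto : ∀ un utn : ℕ → ℝ → ℝ → ℝ, IsClassicalApproximation a un utn u ut → ∀ T, 0 ≤ T →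
    Tendsto (fun n => eLpNorm (fun t => derivWithin (un n t) (Icc 0 1) 1 - γ t) 2
      (volume.restrict (Ioo 0 T))) atTop (𝓝 0)

/-- The energy `E_u(t) = ½ ∫₀¹ (u_t(t,x)² + a(x) u_x(t,x)²) dx`. -/
def energy (a : ℝ → ℝ) (u ut : ℝ → ℝ → ℝ) (t : ℝ) : ℝ :=
  1 / 2 * ∫ x in (0 : ℝ)..1, (ut t x ^ 2 + a x * deriv (u t) x ^ 2)

end DegenerateWave

end

/-!
For a classical solution, differentiate `2 ∫₀¹ x u_x u_t dx` in time and integrate by parts in `x`.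
Since `x |a'| ≤ 2 a`, the weights `x / √a` and `1 - x a' / a` are bounded, so every term is
integrable; this forces the boundary terms at the degenerate endpoint to vanish, and only the one at
`x = 1` survives. The result is `a(1) u_x(t,1)² - ∫₀¹ (u_t² + (a - x a') u_x²) dx`, and integrating
over `(0,T)` gives the multiplier identity. Its right-hand side is continuous in the energy norm,
which is conserved, so `u_x(·,1)` in `L²(0,T)` is a Lipschitz function of the initial state in the
energy space.

The time averages `h⁻¹ ∫ₜᵗ⁺ʰ U(s) ds` of a mild solution `U` are classical solutions and tend to `U`
as `h ↓ 0`. Hence initial states of classical solutions approximate that of `U`, the normal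
derivative extends to `U` by completeness, and the identity passes to the limit.
-/

open MeasureTheory Set Filter Topology

noncomputable section

namespace DegenerateWave

section Integration

variable {α : Type*} [MeasurableSpace α] {μ : Measure α}

lemma norm_toLp_sq {f : α → ℝ} (hf : MemLp f 2 μ) : ‖hf.toLp f‖ ^ 2 = ∫ x, f x ^ 2 ∂μ := by
  rw [← real_inner_self_eq_norm_sq, L2.inner_def]
  refine integral_congr_ae (hf.coeFn_toLp.mono fun x hx => ?_)
  simp [hx, sq]

lemma sq_setIntegral_le {s : Set α} (hs : MeasurableSet s) (hμs : μ s ≠ ⊤) {f : α → ℝ}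
    (hf : MemLp f 2 μ) : (∫ x in s, f x ∂μ) ^ 2 ≤ μ.real s * ∫ x, f x ^ 2 ∂μ := by
  have hinner : inner ℝ (indicatorConstLp 2 hs hμs (1 : ℝ)) (hf.toLp f) = ∫ x in s, f x ∂μ := by
    rw [L2.inner_indicatorConstLp_one]
    exact setIntegral_congr_ae hs (hf.coeFn_toLp.mono fun x hx _ => hx)
  have hcs := real_inner_mul_inner_self_le (indicatorConstLp 2 hs hμs (1 : ℝ)) (hf.toLp f)
  have hone : inner ℝ (indicatorConstLp 2 hs hμs (1 : ℝ)) (indicatorConstLp 2 hs hμs (1 : ℝ)) =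
      μ.real s := by
    rw [L2.inner_indicatorConstLp_indicatorConstLp]
    simp
  rwa [hinner, hone, real_inner_self_eq_norm_sq, norm_toLp_sq, ← sq] at hcs

lemma tendsto_integral_sq_of_tendsto_eLpNorm {ι : Type*} {l : Filter ι} {f : ι → α → ℝ}
    {g : α → ℝ} (hf : ∀ i, MemLp (f i) 2 μ) (hg : MemLp g 2 μ)
    (h : Tendsto (fun i => eLpNorm (f i - g) 2 μ) l (𝓝 0)) :
    Tendsto (fun i => ∫ x, f i x ^ 2 ∂μ) l (𝓝 (∫ x, g x ^ 2 ∂μ)) := by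
  simpa only [norm_toLp_sq] using ((Lp.tendsto_Lp_iff_tendsto_eLpNorm'' f hf g hg).2 h).norm.pow 2

lemma eLpNorm_two_le_ofReal {f : α → ℝ} (hf : MemLp f 2 μ) {B : ℝ} (hB : 0 ≤ B)
    (h : ∫ x, f x ^ 2 ∂μ ≤ B ^ 2) : eLpNorm f 2 μ ≤ ENNReal.ofReal B := by
  rw [← norm_toLp_sq hf] at h
  rw [← ENNReal.ofReal_toReal hf.eLpNorm_ne_top, ← Lp.norm_toLp f hf]
  exact ENNReal.ofReal_le_ofReal (le_of_sq_le_sq h hB)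

end Integration

section HalfOpenInterval

/-- Local absolute continuity in the half-open interval `(b, c]`, in the form in which it enters
`MemV1`. -/
def LocallyACOnIoc (f : ℝ → ℝ) (b c : ℝ) : Prop :=
  ∀ x ∈ Ioo b c, AbsolutelyContinuousOnInterval f x c

variable {E : Type*} [NormedAddCommGroup E] {b c : ℝ}

lemma tendsto_intervalIntegral_nhdsGT [NormedSpace ℝ E] (hbc : b < c) {f : ℝ → E}
    (hf : IntegrableOn f (Ioo b c)) :
    Tendsto (fun x => ∫ t in x..c, f t) (𝓝[>] b) (𝓝 (∫ t in Ioo b c, f t)) := by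
  have hf' : IntegrableOn f (uIcc b c) := by
    rwa [uIcc_of_le hbc.le, integrableOn_Icc_iff_integrableOn_Ioo]
  have hcont : Tendsto (fun x => ∫ t in x..c, f t) (𝓝[uIcc b c] b) (𝓝 (∫ t in b..c, f t)) :=
    intervalIntegral.continuousOn_primitive_interval_left hf' b left_mem_uIcc
  rw [intervalIntegral.integral_of_le hbc.le, integral_Ioc_eq_integral_Ioo,
    uIcc_of_le hbc.le] at hcont
  rw [← nhdsWithin_Ioo_eq_nhdsGT hbc]
  exact hcont.mono_left (nhdsWithin_mono b Ioo_subset_Icc_self)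

lemma tendsto_mul_of_integrableOn_deriv (hbc : b < c) {f g : ℝ → ℝ} (hf : LocallyACOnIoc f b c)
    (hg : LocallyACOnIoc g b c)
    (hint : IntegrableOn (fun x => deriv f x * g x + f x * deriv g x) (Ioo b c)) :
    Tendsto (fun x => f x * g x) (𝓝[>] b)
      (𝓝 (f c * g c - ∫ x in Ioo b c, (deriv f x * g x + f x * deriv g x))) := by
  refine ((tendsto_intervalIntegral_nhdsGT hbc hint).const_sub (f c * g c)).congr' ?_
  filter_upwards [Ioo_mem_nhdsGT hbc] with x hx
  rw [(hf x hx).integral_deriv_mul_eq_sub (hg x hx), sub_sub_cancel]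

lemma not_integrableOn_of_inv_isBigO (hb : 0 < b) {g : ℝ → E}
    (h : (fun x : ℝ => x⁻¹) =O[𝓝[>] 0] g) : ¬ IntegrableOn g (Ioo 0 b) := by
  refine not_integrableOn_of_tendsto_norm_atTop_of_deriv_isBigO_filter (f := Real.log) (𝓝[>] 0)
    (Ioo_mem_nhdsGT hb) ?_ (tendsto_abs_atBot_atTop.comp Real.tendsto_log_nhdsGT_zero) ?_
  · filter_upwards [self_mem_nhdsWithin] with x hx
    exact Real.differentiableAt_log (ne_of_gt hx)
  · simpa only [Real.deriv_log'] using h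

lemma eq_zero_of_tendsto_mul_of_integrableOn (hb : 0 < b) {g : ℝ → ℝ}
    (hg : IntegrableOn g (Ioo 0 b)) {L : ℝ} (h : Tendsto (fun x => x * g x) (𝓝[>] 0) (𝓝 L)) :
    L = 0 := by
  by_contra hL
  refine not_integrableOn_of_inv_isBigO hb ?_ hg
  have hO : (fun _ => L) =O[𝓝[>] 0] fun x => x * g x :=
    ((Asymptotics.isEquivalent_const_iff_tendsto hL).2 h).isBigO_symm
  have hmul := (Asymptotics.isBigO_refl (fun x : ℝ => x⁻¹) (𝓝[>] 0)).mul hO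
  refine (Asymptotics.isBigO_self_const_mul hL _ _).trans (hmul.congr' ?_ ?_)
  · filter_upwards with x using mul_comm _ _
  · filter_upwards [self_mem_nhdsWithin] with x hx
    exact inv_mul_cancel_left₀ (ne_of_gt hx) _

lemma tendsto_id_mul_of_integrableOn (hb : 0 < b) {g : ℝ → ℝ} (hg : LocallyACOnIoc g 0 b)
    (hint : IntegrableOn (fun x => g x + x * deriv g x) (Ioo 0 b)) :
    Tendsto (fun x => x * g x) (𝓝[>] 0)
      (𝓝 (b * g b - ∫ x in Ioo 0 b, (g x + x * deriv g x))) := by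
  have hid : LocallyACOnIoc id 0 b := fun x _ =>
    contDiff_id.contDiffOn.absolutelyContinuousOnInterval
  simpa only [deriv_id, one_mul, id] using tendsto_mul_of_integrableOn_deriv hb hid hg (by
    simpa only [deriv_id, one_mul, id] using hint)

lemma integral_add_id_mul_deriv (hb : 0 < b) {g : ℝ → ℝ} (hg : LocallyACOnIoc g 0 b)
    (hint : IntegrableOn g (Ioo 0 b))
    (hint' : IntegrableOn (fun x => g x + x * deriv g x) (Ioo 0 b)) :
    ∫ x in Ioo 0 b, (g x + x * deriv g x) = b * g b := by
  linarith [eq_zero_of_tendsto_mul_of_integrableOn hb hint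
    (tendsto_id_mul_of_integrableOn hb hg hint')]

lemma tendsto_id_mul_zero (hb : 0 < b) {g : ℝ → ℝ} (hg : LocallyACOnIoc g 0 b)
    (hint : IntegrableOn g (Ioo 0 b))
    (hint' : IntegrableOn (fun x => g x + x * deriv g x) (Ioo 0 b)) :
    Tendsto (fun x => x * g x) (𝓝[>] 0) (𝓝 0) := by
  have hlim := tendsto_id_mul_of_integrableOn hb hg hint'
  rwa [eq_zero_of_tendsto_mul_of_integrableOn hb hint hlim] at hlim

lemma LocallyACOnIoc.sq {f : ℝ → ℝ} (hf : LocallyACOnIoc f b c) :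
    LocallyACOnIoc (fun x => f x ^ 2) b c := by
  simp only [pow_two]
  exact fun x hx => (hf x hx).fun_mul (hf x hx)

lemma LocallyACOnIoc.ae_differentiableAt {f : ℝ → ℝ} (hbc : b < c) (hf : LocallyACOnIoc f b c) :
    ∀ᵐ x ∂volume.restrict (Ioo b c), DifferentiableAt ℝ f x := by
  obtain ⟨ε, -, hε, hεb⟩ := exists_seq_strictAnti_tendsto' hbc
  rw [ae_restrict_iff' measurableSet_Ioo]
  filter_upwards [ae_all_iff.2 fun n => (hf (ε n) (hε n)).ae_differentiableAt] with x hx hxbc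
  obtain ⟨n, hn⟩ := (hεb.eventually_lt_const hxbc.1).exists
  exact hx n (Icc_subset_uIcc ⟨hn.le, hxbc.2.le⟩)

lemma sq_le_mul_integral_deriv_sq {p : ℝ → ℝ} (hp : AbsolutelyContinuousOnInterval p b c)
    (hp' : MemLp (deriv p) 2 (volume.restrict (Ioo b c))) (hpb : p b = 0) {x : ℝ}
    (hx : x ∈ Ioo b c) : p x ^ 2 ≤ (x - b) * ∫ t in Ioo b c, deriv p t ^ 2 := by
  have hpx : AbsolutelyContinuousOnInterval p b x :=
    hp.mono (uIcc_subset_uIcc left_mem_uIcc (Icc_subset_uIcc (Ioo_subset_Icc_self hx)))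
  have hsub : Ioo b x ⊆ Ioo b c := Ioo_subset_Ioo_right hx.2.le
  have hftc : ∫ t in Ioo b x, deriv p t = p x := by
    rw [← integral_Ioc_eq_integral_Ioo, ← intervalIntegral.integral_of_le hx.1.le,
      hpx.integral_deriv_eq_sub, hpb, sub_zero]
  have hcs := sq_setIntegral_le measurableSet_Ioo (measure_ne_top _ (Ioo b x)) hp'
  rwa [Measure.restrict_restrict_of_subset hsub, hftc, measureReal_restrict_apply measurableSet_Ioo,
    inter_eq_self_of_subset_left hsub, Real.volume_real_Ioo_of_le hx.1.le] at hcs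

end HalfOpenInterval

lemma hasDerivWithinAt_Icc_of_ae_deriv_eq {w q : ℝ → ℝ} {b c : ℝ} (hbc : b ≤ c)
    (hw : AbsolutelyContinuousOnInterval w b c) (hq : ContinuousOn q (Icc b c))
    (h : ∀ᵐ x, x ∈ Ioo b c → deriv w x = q x) {x : ℝ} (hx : x ∈ Icc b c) :
    HasDerivWithinAt w (q x) (Icc b c) x := by
  set Q : ℝ → ℝ := IccExtend hbc ((Icc b c).domRestrict q)
  have hQ : Continuous Q := (continuousOn_iff_continuous_domRestrict.1 hq).Icc_extend'
  have hQq : ∀ y ∈ Icc b c, Q y = q y := fun y hy => IccExtend_of_mem hbc _ hy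
  have hprim : ∀ y ∈ Icc b c, w y = w b + ∫ s in b..y, Q s := by
    intro y hy
    have hwy : AbsolutelyContinuousOnInterval w b y :=
      hw.mono (uIcc_subset_uIcc left_mem_uIcc (Icc_subset_uIcc hy))
    have hcongr : ∫ s in b..y, deriv w s = ∫ s in b..y, Q s := by
      simp only [intervalIntegral.integral_of_le hy.1, integral_Ioc_eq_integral_Ioo]
      refine setIntegral_congr_ae measurableSet_Ioo (h.mono fun s hs hsy => ?_)
      have hsc : s < c := hsy.2.trans_le hy.2
      rw [hs ⟨hsy.1, hsc⟩, hQq s ⟨hsy.1.le, hsc.le⟩]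
    rw [← hcongr, hwy.integral_deriv_eq_sub, add_sub_cancel]
  rw [← hQq x hx]
  exact ((hQ.integral_hasStrictDerivAt b x).hasDerivAt.const_add _).hasDerivWithinAt.congr hprim
    (hprim x hx)

section TimeDerivative

variable {E : Type*} [NormedAddCommGroup E] [NormedSpace ℝ E]

lemma hasDerivWithinAt_Ici_intervalIntegral [CompleteSpace E] {f : ℝ → E}
    (hf : ContinuousOn f (Ici 0)) {t : ℝ} (ht : 0 ≤ t) :
    HasDerivWithinAt (fun s => ∫ r in (0 : ℝ)..s, f r) (f t) (Ici 0) t := by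
  have hcont : Continuous fun s => f (max s 0) :=
    hf.comp_continuous (by fun_prop) fun s => le_max_right s 0
  have heq : ∀ s ∈ Ici (0 : ℝ), ∫ r in (0 : ℝ)..s, f r = ∫ r in (0 : ℝ)..s, f (max r 0) := by
    intro s hs
    refine intervalIntegral.integral_congr fun r hr => ?_
    rw [uIcc_of_le hs] at hr
    simp only [max_eq_left hr.1]
  have hderiv := (hcont.integral_hasStrictDerivAt 0 t).hasDerivAt.hasDerivWithinAt (s := Ici 0)
  rw [max_eq_left ht] at hderiv
  exact hderiv.congr heq (heq t ht)

/-- The forward difference quotient with step `h`. It is applied both to curves in Banach spaces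
and to representatives `ℝ → ℝ → ℝ`, hence no topology on `E`. -/
def diffQuot {E : Type*} [AddCommGroup E] [Module ℝ E] (h : ℝ) (F : ℝ → E) (t : ℝ) : E :=
  h⁻¹ • (F (t + h) - F t)

lemma hasDerivWithinAt_diffQuot {F F' : ℝ → E} {h : ℝ} (hh : 0 ≤ h)
    (hF : ∀ s, 0 ≤ s → HasDerivWithinAt F (F' s) (Ici 0) s) {t : ℝ} (ht : 0 ≤ t) :
    HasDerivWithinAt (diffQuot h F) (diffQuot h F' t) (Ici 0) t := by
  have hshift : HasDerivWithinAt (fun s => s + h) 1 (Ici 0) t :=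
    ((hasDerivAt_id t).add_const h).hasDerivWithinAt
  have hcomp := (hF (t + h) (add_nonneg ht hh)).scomp t hshift fun s hs => add_nonneg hs hh
  rw [one_smul] at hcomp
  exact (hcomp.fun_sub (hF t ht)).fun_const_smul h⁻¹

lemma continuousOn_diffQuot {F : ℝ → E} {h : ℝ} (hh : 0 ≤ h) (hF : ContinuousOn F (Ici 0)) :
    ContinuousOn (diffQuot h F) (Ici 0) :=
  ((hF.comp (by fun_prop) fun _ hs => add_nonneg hs hh).sub hF).const_smul h⁻¹

lemma tendsto_diffQuot {F : ℝ → E} {F' : E} {t : ℝ} (hF : HasDerivWithinAt F F' (Ici t) t) :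
    Tendsto (fun h => diffQuot h F t) (𝓝[>] 0) (𝓝 F') := by
  have hslope := hasDerivWithinAt_iff_tendsto_slope.1 hF
  rw [Ici_sdiff_left] at hslope
  have hadd : Tendsto (fun h => t + h) (𝓝[>] 0) (𝓝[>] t) := by
    refine tendsto_nhdsWithin_iff.2 ⟨?_, ?_⟩
    · exact ((continuous_const_add t).tendsto' 0 t (add_zero t)).mono_left nhdsWithin_le_nhds
    · filter_upwards [self_mem_nhdsWithin] with h hh using lt_add_of_pos_right t hh
  refine (hslope.comp hadd).congr fun h => ?_
  simp only [Function.comp_apply, slope_def_module, add_sub_cancel_left, diffQuot]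

end TimeDerivative

section DenseExtension

open scoped NNReal ENNReal

variable {α F : Type*} [MeasurableSpace α] {μ : Measure α} [NormedAddCommGroup F] {p : ℝ≥0∞}

lemma exists_tendsto_eLpNorm_restrict_iUnion [CompleteSpace F] (hp : 1 ≤ p) {s : ℕ → Set α}
    {f : ℕ → α → F} (hf : ∀ n, AEStronglyMeasurable (f n) (μ.restrict (⋃ k, s k)))
    {B : ℕ → ℕ → ℝ≥0∞} (hB : ∀ k, ∑' N, B k N ≠ ⊤)
    (hcauchy : ∀ k N n m, N ≤ n → N ≤ m → eLpNorm (f n - f m) p (μ.restrict (s k)) < B k N) :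
    ∃ γ : α → F, AEStronglyMeasurable γ (μ.restrict (⋃ k, s k)) ∧
      ∀ k, Tendsto (fun n => eLpNorm (f n - γ) p (μ.restrict (s k))) atTop (𝓝 0) := by
  have hle (k : ℕ) : μ.restrict (s k) ≤ μ.restrict (⋃ k, s k) :=
    Measure.restrict_mono_set μ (subset_iUnion s k)
  have hconv : ∀ᵐ x ∂μ.restrict (⋃ k, s k), ∃ l, Tendsto (fun n => f n x) atTop (𝓝 l) := by
    rw [ae_restrict_iUnion_iff]
    exact fun k => Lp.ae_tendsto_of_cauchy_eLpNorm (fun n => (hf n).mono_measure (hle k)) hp (hB k)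
      (hcauchy k)
  obtain ⟨γ, hγ, hlim⟩ := exists_stronglyMeasurable_limit_of_tendsto_ae hf hconv
  exact ⟨γ, hγ.aestronglyMeasurable, fun k => Lp.cauchy_tendsto_of_tendsto
    (fun n => (hf n).mono_measure (hle k)) γ (hB k) (hcauchy k) (ae_mono (hle k) hlim)⟩

variable {ι X : Type*} [PseudoEMetricSpace X] {x : ι → X} {x₀ : X}

lemma exists_seq_edist_lt_of_mem_closure_range (hx₀ : x₀ ∈ closure (range x)) :
    ∃ i : ℕ → ι, ∀ n, edist (x (i n)) x₀ < 2⁻¹ ^ n := by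
  have hex (n : ℕ) : ∃ i, edist (x i) x₀ < 2⁻¹ ^ n := by
    obtain ⟨_, ⟨i, rfl⟩, hi⟩ := EMetric.mem_closure_iff.1 hx₀ (2⁻¹ ^ n)
      (ENNReal.pow_pos (by simp) n)
    exact ⟨i, edist_comm (x i) x₀ ▸ hi⟩
  exact ⟨fun n => (hex n).choose, fun n => (hex n).choose_spec⟩

lemma tendsto_eLpNorm_sub_of_le {ν : Measure α} (hp : 1 ≤ p) {Φ : ι → α → F} {C : ℝ≥0}
    (hΦ : ∀ i, AEStronglyMeasurable (Φ i) ν)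
    (hlip : ∀ i j, eLpNorm (Φ i - Φ j) p ν ≤ C * edist (x i) (x j)) {i j : ℕ → ι} {γ : α → F}
    (hγ : AEStronglyMeasurable γ ν) (hi : Tendsto (fun n => x (i n)) atTop (𝓝 x₀))
    (hj : Tendsto (fun n => x (j n)) atTop (𝓝 x₀))
    (hlim : Tendsto (fun n => eLpNorm (Φ (j n) - γ) p ν) atTop (𝓝 0)) :
    Tendsto (fun n => eLpNorm (Φ (i n) - γ) p ν) atTop (𝓝 0) := by
  have hdist : Tendsto (fun n => (C : ℝ≥0∞) * edist (x (i n)) (x (j n))) atTop (𝓝 0) := by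
    simpa only [edist_self, mul_zero] using
      ENNReal.Tendsto.const_mul (hi.edist hj) (.inr ENNReal.coe_ne_top)
  have hsum := hdist.add hlim
  rw [add_zero] at hsum
  refine tendsto_of_tendsto_of_tendsto_of_le_of_le tendsto_const_nhds hsum (fun _ => zero_le)
    fun n => ?_
  calc eLpNorm (Φ (i n) - γ) p ν
      = eLpNorm ((Φ (i n) - Φ (j n)) + (Φ (j n) - γ)) p ν := by rw [sub_add_sub_cancel]
    _ ≤ eLpNorm (Φ (i n) - Φ (j n)) p ν + eLpNorm (Φ (j n) - γ) p ν :=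
        eLpNorm_add_le ((hΦ _).sub (hΦ _)) ((hΦ _).sub hγ) hp
    _ ≤ _ := by gcongr; exact hlip _ _

lemma exists_tendsto_eLpNorm_of_mem_closure_range [CompleteSpace F] (hp : 1 ≤ p) {s : ℕ → Set α}
    {Φ : ι → α → F} (hΦ : ∀ i, AEStronglyMeasurable (Φ i) (μ.restrict (⋃ k, s k))) {C : ℕ → ℝ≥0}
    (hlip : ∀ k i j, eLpNorm (Φ i - Φ j) p (μ.restrict (s k)) ≤ C k * edist (x i) (x j))
    (hx₀ : x₀ ∈ closure (range x)) :
    ∃ γ : α → F, AEStronglyMeasurable γ (μ.restrict (⋃ k, s k)) ∧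
      ∀ i : ℕ → ι, Tendsto (fun n => x (i n)) atTop (𝓝 x₀) →
        ∀ k, Tendsto (fun n => eLpNorm (Φ (i n) - γ) p (μ.restrict (s k))) atTop (𝓝 0) := by
  obtain ⟨j, hj⟩ := exists_seq_edist_lt_of_mem_closure_range hx₀
  have hgeom : ∑' N : ℕ, (2⁻¹ : ℝ≥0∞) ^ N ≠ ⊤ := by
    rw [ENNReal.tsum_geometric]
    simp
  have hpow {N n : ℕ} (hn : N ≤ n) : edist (x (j n)) x₀ ≤ 2⁻¹ ^ N :=
    (hj n).le.trans (pow_le_pow_right_of_le_one' (by simp) hn)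
  have hcauchy : ∀ k N n m, N ≤ n → N ≤ m →
      eLpNorm (Φ (j n) - Φ (j m)) p (μ.restrict (s k)) < (C k * 2 + 1) * 2⁻¹ ^ N := by
    intro k N n m hn hm
    calc eLpNorm (Φ (j n) - Φ (j m)) p (μ.restrict (s k))
        ≤ C k * (edist (x (j n)) x₀ + edist (x (j m)) x₀) :=
          (hlip k _ _).trans (by gcongr; exact edist_triangle_right _ _ _)
      _ ≤ C k * (2⁻¹ ^ N + 2⁻¹ ^ N) := by gcongr <;> exact hpow ‹_›
      _ = C k * 2 * 2⁻¹ ^ N := by ring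
      _ < C k * 2 * 2⁻¹ ^ N + 2⁻¹ ^ N :=
          ENNReal.lt_add_right (by finiteness) (by simp)
      _ = (C k * 2 + 1) * 2⁻¹ ^ N := by ring
  obtain ⟨γ, hγ, hlim⟩ := exists_tendsto_eLpNorm_restrict_iUnion hp (fun n => hΦ (j n))
    (fun k => by rw [ENNReal.tsum_mul_left]; finiteness) hcauchy
  have hjx : Tendsto (fun n => x (j n)) atTop (𝓝 x₀) :=
    tendsto_iff_edist_tendsto_0.2 (tendsto_of_tendsto_of_tendsto_of_le_of_le tendsto_const_nhds
      (ENNReal.tendsto_pow_atTop_nhds_zero_of_lt_one (by simp)) (fun _ => zero_le)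
      fun n => (hj n).le)
  have hle (k : ℕ) : μ.restrict (s k) ≤ μ.restrict (⋃ k, s k) :=
    Measure.restrict_mono_set μ (subset_iUnion s k)
  exact ⟨γ, hγ, fun i hi k => tendsto_eLpNorm_sub_of_le hp (fun i => (hΦ i).mono_measure (hle k))
    (hlip k) (hγ.mono_measure (hle k)) hi hjx (hlim k)⟩

end DenseExtension

section L2Classes

open scoped ENNReal

variable {f g m : ℝ → ℝ}

lemma toL2_of_memLp (hf : MemLp f 2 unitMeasure) : toL2 f = hf.toLp f :=
  dif_pos hf

lemma coeFn_toL2 (hf : MemLp f 2 unitMeasure) : toL2 f =ᵐ[unitMeasure] f := by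
  rw [toL2_of_memLp hf]
  exact hf.coeFn_toLp

lemma toL2_coeFn (F : L2) : toL2 F = F := by
  rw [toL2_of_memLp (Lp.memLp F), Lp.toLp_coeFn]

lemma toL2_congr (h : f =ᵐ[unitMeasure] g) : toL2 f = toL2 g := by
  by_cases hf : MemLp f 2 unitMeasure
  · have hg : MemLp g 2 unitMeasure := (memLp_congr_ae h).1 hf
    rw [toL2_of_memLp hf, toL2_of_memLp hg, MemLp.toLp_eq_toLp_iff]
    exact h
  · have hg : ¬ MemLp g 2 unitMeasure := fun hg => hf ((memLp_congr_ae h).2 hg)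
    rw [toL2, toL2, dif_neg hf, dif_neg hg]

lemma toL2_sub (hf : MemLp f 2 unitMeasure) (hg : MemLp g 2 unitMeasure) :
    toL2 (f - g) = toL2 f - toL2 g := by
  rw [toL2_of_memLp hf, toL2_of_memLp hg, toL2_of_memLp (hf.sub hg), MemLp.toLp_sub]

lemma toL2_const_smul (c : ℝ) (hf : MemLp f 2 unitMeasure) : toL2 (c • f) = c • toL2 f := by
  rw [toL2_of_memLp hf, toL2_of_memLp (hf.const_smul c), MemLp.toLp_const_smul]

lemma inner_toL2 (hf : MemLp f 2 unitMeasure) (hg : MemLp g 2 unitMeasure) :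
    inner ℝ (toL2 f) (toL2 g) = ∫ x, f x * g x ∂unitMeasure := by
  rw [L2.inner_def]
  refine integral_congr_ae ?_
  filter_upwards [coeFn_toL2 hf, coeFn_toL2 hg] with x hfx hgx
  rw [hfx, hgx]
  exact mul_comm _ _

lemma norm_toL2_sq (hf : MemLp f 2 unitMeasure) :
    ‖toL2 f‖ ^ 2 = ∫ x, f x ^ 2 ∂unitMeasure := by
  rw [toL2_of_memLp hf, norm_toLp_sq]

lemma memLp_top_unitMeasure {C : ℝ} (hm : ContinuousOn m (Ioo 0 1))
    (hC : ∀ x ∈ Ioo (0 : ℝ) 1, |m x| ≤ C) : MemLp m ∞ unitMeasure :=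
  memLp_top_of_bound (hm.aestronglyMeasurable measurableSet_Ioo) C
    ((ae_restrict_mem measurableSet_Ioo).mono hC)

lemma memLp_unitMeasure_of_continuousOn_Icc (hf : ContinuousOn f (Icc 0 1)) :
    MemLp f 2 unitMeasure := by
  obtain ⟨C, hC⟩ := isCompact_Icc.exists_bound_of_continuousOn hf
  exact (memLp_top_unitMeasure (hf.mono Ioo_subset_Icc_self)
    fun x hx => hC x (Ioo_subset_Icc_self hx)).mono_exponent le_top

/-- Multiplication by a bounded function as an operator on `L²(0,1)`. -/
def mulL2 (hm : MemLp m ∞ unitMeasure) : L2 →L[ℝ] L2 :=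
  (ContinuousLinearMap.mul ℝ ℝ).holderL unitMeasure ∞ 2 2 (hm.toLp m)

lemma coeFn_mulL2 (hm : MemLp m ∞ unitMeasure) (F : L2) :
    mulL2 hm F =ᵐ[unitMeasure] fun x => m x * F x := by
  filter_upwards [(ContinuousLinearMap.mul ℝ ℝ).coeFn_holder (r := 2) (hm.toLp m) F,
    hm.coeFn_toLp] with x hx hmx
  rw [mulL2, ContinuousLinearMap.holderL_apply_apply, hx, ContinuousLinearMap.mul_apply', hmx]

lemma mulL2_toL2 (hm : MemLp m ∞ unitMeasure) (hf : MemLp f 2 unitMeasure) :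
    mulL2 hm (toL2 f) = toL2 (m * f) := by
  rw [← toL2_coeFn (mulL2 hm (toL2 f))]
  refine toL2_congr ?_
  filter_upwards [coeFn_mulL2 hm (toL2 f), coeFn_toL2 hf] with x hx hfx
  rw [hx, hfx, Pi.mul_apply]

lemma norm_mulL2_apply_le (hm : MemLp m ∞ unitMeasure) {C : ℝ}
    (hC : ∀ x ∈ Ioo (0 : ℝ) 1, |m x| ≤ C) (F : L2) : ‖mulL2 hm F‖ ≤ C * ‖F‖ := by
  refine Lp.norm_le_mul_norm_of_ae_le_mul ?_
  filter_upwards [coeFn_mulL2 hm F, ae_restrict_mem measurableSet_Ioo] with x hx hx01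
  rw [hx, norm_mul]
  exact mul_le_mul_of_nonneg_right (hC x hx01) (norm_nonneg _)

end L2Classes

variable {a : ℝ → ℝ}

namespace IsCoefficient

open scoped ENNReal

lemma hasDerivAt (ha : IsCoefficient a) {x : ℝ} (hx : x ∈ Ioo (0 : ℝ) 1) :
    HasDerivAt a (coeffDeriv a x) x := by
  rw [coeffDeriv, derivWithin_of_mem_nhds (Icc_mem_nhds hx.1 hx.2)]
  exact ((ha.contDiffOn.differentiableOn one_ne_zero x (Ioo_subset_Ioc_self hx)).differentiableAt
    (Ioc_mem_nhds hx.1 hx.2)).hasDerivAt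

lemma continuousOn_coeffDeriv (ha : IsCoefficient a) : ContinuousOn (coeffDeriv a) (Ioo 0 1) :=
  ((ha.contDiffOn.mono Ioo_subset_Ioc_self).continuousOn_deriv_of_isOpen isOpen_Ioo le_rfl).congr
    fun _ hx => (ha.hasDerivAt hx).deriv.symm

lemma continuousOn_Ioo (ha : IsCoefficient a) : ContinuousOn a (Ioo 0 1) :=
  ha.continuousOn.mono Ioo_subset_Icc_self

lemma pos_Ioo (ha : IsCoefficient a) {x : ℝ} (hx : x ∈ Ioo (0 : ℝ) 1) : 0 < a x :=
  ha.pos x (Ioo_subset_Ioc_self hx)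

lemma pos_one (ha : IsCoefficient a) : 0 < a 1 :=
  ha.pos 1 (right_mem_Ioc.2 one_pos)

lemma sqrt_pos (ha : IsCoefficient a) {x : ℝ} (hx : x ∈ Ioo (0 : ℝ) 1) : 0 < √(a x) :=
  Real.sqrt_pos.2 (ha.pos_Ioo hx)

lemma continuousOn_sqrt (ha : IsCoefficient a) : ContinuousOn (fun x => √(a x)) (Ioo 0 1) :=
  ha.continuousOn_Ioo.sqrt

lemma memLp_sqrt (ha : IsCoefficient a) : MemLp (fun x => √(a x)) 2 unitMeasure :=
  memLp_unitMeasure_of_continuousOn_Icc ha.continuousOn.sqrt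

lemma mul_abs_coeffDeriv_le (ha : IsCoefficient a) {x : ℝ} (hx : x ∈ Ioo (0 : ℝ) 1) :
    x * |coeffDeriv a x| ≤ 2 * a x := by
  rw [← div_le_iff₀ (ha.pos_Ioo hx)]
  exact (le_csSup ha.bddAbove (mem_image_of_mem _ (Ioo_subset_Ioc_self hx))).trans
    ha.mu_lt_two.le

lemma antitoneOn_div_sq (ha : IsCoefficient a) : AntitoneOn (fun x => a x / x ^ 2) (Ioc 0 1) := by
  have hderiv : ∀ x ∈ interior (Ioc (0 : ℝ) 1), HasDerivWithinAt (fun x => a x / x ^ 2)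
      ((coeffDeriv a x * x ^ 2 - a x * (2 * x)) / (x ^ 2) ^ 2) (interior (Ioc 0 1)) x := by
    intro x hx
    rw [interior_Ioc] at hx
    have hsq : HasDerivAt (fun x : ℝ => x ^ 2) (2 * x) x := by simpa using hasDerivAt_pow 2 x
    exact ((ha.hasDerivAt hx).fun_div hsq (pow_ne_zero 2 hx.1.ne')).hasDerivWithinAt
  refine antitoneOn_of_hasDerivWithinAt_nonpos (convex_Ioc 0 1) ?_ hderiv fun x hx => ?_
  · exact (ha.continuousOn.mono Ioc_subset_Icc_self).div (by fun_prop)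
      fun x hx => pow_ne_zero 2 hx.1.ne'
  · rw [interior_Ioc] at hx
    refine div_nonpos_of_nonpos_of_nonneg ?_ (by positivity)
    have hle : x * coeffDeriv a x ≤ 2 * a x :=
      (mul_le_mul_of_nonneg_left (le_abs_self _) hx.1.le).trans (ha.mul_abs_coeffDeriv_le hx)
    linarith [mul_le_mul_of_nonneg_left hle hx.1.le]

lemma mul_sq_le (ha : IsCoefficient a) {x : ℝ} (hx : x ∈ Ioc (0 : ℝ) 1) : a 1 * x ^ 2 ≤ a x := by
  have hle := ha.antitoneOn_div_sq hx (right_mem_Ioc.2 one_pos) hx.2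
  simp only [one_pow, div_one] at hle
  rwa [le_div_iff₀ (pow_pos hx.1 2)] at hle

lemma abs_div_sqrt_le (ha : IsCoefficient a) {x : ℝ} (hx : x ∈ Ioo (0 : ℝ) 1) :
    |x / √(a x)| ≤ 1 / √(a 1) := by
  rw [abs_div, abs_of_pos hx.1, abs_of_pos (ha.sqrt_pos hx),
    div_le_div_iff₀ (ha.sqrt_pos hx) (Real.sqrt_pos.2 ha.pos_one), one_mul]
  refine Real.le_sqrt_of_sq_le ?_
  rw [mul_pow, Real.sq_sqrt ha.pos_one.le, mul_comm]
  exact ha.mul_sq_le (Ioo_subset_Ioc_self hx)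

lemma abs_one_sub_mul_coeffDeriv_div_le (ha : IsCoefficient a) {x : ℝ} (hx : x ∈ Ioo (0 : ℝ) 1) :
    |1 - x * coeffDeriv a x / a x| ≤ 3 := by
  have hquot : |x * coeffDeriv a x / a x| ≤ 2 := by
    rw [abs_div, abs_mul, abs_of_pos hx.1, abs_of_pos (ha.pos_Ioo hx),
      div_le_iff₀ (ha.pos_Ioo hx)]
    exact ha.mul_abs_coeffDeriv_le hx
  calc |1 - x * coeffDeriv a x / a x| ≤ |1| + |x * coeffDeriv a x / a x| := abs_sub _ _
    _ ≤ 3 := by rw [abs_one]; linarith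

lemma memLp_top_div_sqrt (ha : IsCoefficient a) : MemLp (fun x => x / √(a x)) ∞ unitMeasure :=
  memLp_top_unitMeasure (continuousOn_id.div ha.continuousOn_sqrt fun _ hx => (ha.sqrt_pos hx).ne')
    fun _ => ha.abs_div_sqrt_le

lemma memLp_top_one_sub_mul_coeffDeriv_div (ha : IsCoefficient a) :
    MemLp (fun x => 1 - x * coeffDeriv a x / a x) ∞ unitMeasure :=
  memLp_top_unitMeasure (continuousOn_const.sub ((continuousOn_id.mul
    ha.continuousOn_coeffDeriv).div ha.continuousOn_Ioo fun _ hx => (ha.pos_Ioo hx).ne'))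
    fun _ => ha.abs_one_sub_mul_coeffDeriv_div_le

/-- Multiplication by `x / √a`, which turns `√a w'` into the multiplier `x w'`. -/
def radialMul (ha : IsCoefficient a) : L2 →L[ℝ] L2 :=
  mulL2 ha.memLp_top_div_sqrt

/-- Multiplication by `1 - x a' / a`, the weight of `a w'²` in the multiplier identity. -/
def defectMul (ha : IsCoefficient a) : L2 →L[ℝ] L2 :=
  mulL2 ha.memLp_top_one_sub_mul_coeffDeriv_div

lemma norm_radialMul_apply_le (ha : IsCoefficient a) (F : L2) :
    ‖ha.radialMul F‖ ≤ 1 / √(a 1) * ‖F‖ :=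
  norm_mulL2_apply_le _ (fun _ => ha.abs_div_sqrt_le) F

lemma norm_defectMul_apply_le (ha : IsCoefficient a) (F : L2) : ‖ha.defectMul F‖ ≤ 3 * ‖F‖ :=
  norm_mulL2_apply_le _ (fun _ => ha.abs_one_sub_mul_coeffDeriv_div_le) F

lemma exists_lipschitzOnWith_of_one_le_mu (ha : IsCoefficient a) (h : 1 ≤ mu a) :
    ∃ K, LipschitzOnWith K a (Icc 0 1) := by
  have hfloor : ⌊mu a⌋₊ = 1 :=
    Nat.floor_eq_on_Ico 1 _ ⟨mod_cast h, by norm_num; exact ha.mu_lt_two⟩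
  have hC1 := ha.contDiffOn_floor
  rw [hfloor, Nat.cast_one] at hC1
  exact hC1.exists_lipschitzOnWith one_ne_zero (convex_Icc 0 1) isCompact_Icc

lemma isBigO_id_of_one_le_mu (ha : IsCoefficient a) (h : 1 ≤ mu a) : a =O[𝓝[>] 0] fun x => x := by
  obtain ⟨K, hK⟩ := ha.exists_lipschitzOnWith_of_one_le_mu h
  refine Asymptotics.IsBigO.of_bound K ?_
  filter_upwards [Ioo_mem_nhdsGT zero_lt_one] with x hx
  simpa [ha.zero] using hK.norm_sub_le (Ioo_subset_Icc_self hx) (left_mem_Icc.2 zero_le_one)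

lemma absolutelyContinuousOnInterval_inv (ha : IsCoefficient a) {ε : ℝ} (hε : ε ∈ Ioo (0 : ℝ) 1) :
    AbsolutelyContinuousOnInterval (fun x => (a x)⁻¹) ε 1 := by
  have hsub : uIcc ε 1 ⊆ Ioc 0 1 := by
    rw [uIcc_of_le hε.2.le]
    exact fun x hx => ⟨hε.1.trans_le hx.1, hx.2⟩
  exact ((ha.contDiffOn.mono hsub).inv
    fun x hx => (ha.pos x (hsub hx)).ne').absolutelyContinuousOnInterval

end IsCoefficient

section EnergySpace

variable {w v : ℝ → ℝ}

lemma div_sqrt_mul_weightedDeriv (ha : IsCoefficient a) (w : ℝ → ℝ) {x : ℝ}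
    (hx : x ∈ Ioo (0 : ℝ) 1) : x / √(a x) * weightedDeriv a w x = x * deriv w x := by
  rw [weightedDeriv, ← mul_assoc, div_mul_cancel₀ _ (ha.sqrt_pos hx).ne']

lemma weightedDeriv_sq (ha : IsCoefficient a) (w : ℝ → ℝ) {x : ℝ} (hx : x ∈ Ioo (0 : ℝ) 1) :
    weightedDeriv a w x ^ 2 = a x * deriv w x ^ 2 := by
  rw [weightedDeriv, mul_pow, Real.sq_sqrt (ha.pos_Ioo hx).le]

lemma div_sqrt_mul_weightedDeriv_ae (ha : IsCoefficient a) (w : ℝ → ℝ) :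
    (fun x => x / √(a x)) * weightedDeriv a w =ᵐ[unitMeasure] fun x => x * deriv w x :=
  (ae_restrict_mem measurableSet_Ioo).mono fun _ hx => div_sqrt_mul_weightedDeriv ha w hx

lemma defect_mul_ae (ha : IsCoefficient a) (w : ℝ → ℝ) :
    (fun x => (1 - x * coeffDeriv a x / a x) * weightedDeriv a w x * weightedDeriv a w x)
      =ᵐ[unitMeasure] fun x => (a x - x * coeffDeriv a x) * deriv w x ^ 2 := by
  filter_upwards [ae_restrict_mem measurableSet_Ioo] with x hx
  rw [mul_assoc, ← sq, weightedDeriv_sq ha w hx]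
  field_simp [(ha.pos_Ioo hx).ne']

namespace MemV1

lemma ae_differentiableAt (hw : MemV1 a w) : ∀ᵐ x ∂unitMeasure, DifferentiableAt ℝ w x :=
  LocallyACOnIoc.ae_differentiableAt one_pos hw.locallyAC

lemma memLp_id_mul_deriv (ha : IsCoefficient a) (hw : MemV1 a w) :
    MemLp (fun x => x * deriv w x) 2 unitMeasure :=
  (hw.memLp_weightedDeriv.mul ha.memLp_top_div_sqrt).ae_eq (div_sqrt_mul_weightedDeriv_ae ha w)

lemma radialMul_toL2 (ha : IsCoefficient a) (hw : MemV1 a w) :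
    ha.radialMul (toL2 (weightedDeriv a w)) = toL2 (fun x => x * deriv w x) := by
  rw [IsCoefficient.radialMul, mulL2_toL2 _ hw.memLp_weightedDeriv,
    toL2_congr (div_sqrt_mul_weightedDeriv_ae ha w)]

lemma inner_radialMul (ha : IsCoefficient a) (hw : MemV1 a w) (hv : MemLp v 2 unitMeasure) :
    inner ℝ (ha.radialMul (toL2 (weightedDeriv a w))) (toL2 v) =
      ∫ x, x * deriv w x * v x ∂unitMeasure := by
  rw [hw.radialMul_toL2 ha, inner_toL2 (hw.memLp_id_mul_deriv ha) hv]

lemma integrable_id_mul_deriv_mul (ha : IsCoefficient a) (hw : MemV1 a w)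
    (hv : MemLp v 2 unitMeasure) : Integrable (fun x => x * deriv w x * v x) unitMeasure :=
  (hw.memLp_id_mul_deriv ha).integrable_mul hv

lemma memLp_defect (ha : IsCoefficient a) (hw : MemV1 a w) :
    MemLp ((fun x => 1 - x * coeffDeriv a x / a x) * weightedDeriv a w) 2 unitMeasure :=
  hw.memLp_weightedDeriv.mul ha.memLp_top_one_sub_mul_coeffDeriv_div

lemma integrable_defect (ha : IsCoefficient a) (hw : MemV1 a w) :
    Integrable (fun x => (a x - x * coeffDeriv a x) * deriv w x ^ 2) unitMeasure :=
  (integrable_congr (defect_mul_ae ha w)).1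
    ((hw.memLp_defect ha).integrable_mul hw.memLp_weightedDeriv)

lemma inner_defectMul (ha : IsCoefficient a) (hw : MemV1 a w) :
    inner ℝ (ha.defectMul (toL2 (weightedDeriv a w))) (toL2 (weightedDeriv a w)) =
      ∫ x, (a x - x * coeffDeriv a x) * deriv w x ^ 2 ∂unitMeasure := by
  rw [IsCoefficient.defectMul, mulL2_toL2 _ hw.memLp_weightedDeriv,
    inner_toL2 (hw.memLp_defect ha) hw.memLp_weightedDeriv,
    ← integral_congr_ae (defect_mul_ae ha w)]
  rfl

lemma sq_add_id_mul_deriv_sq_ae (hw : MemV1 a w) :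
    (fun x => w x ^ 2 + x * deriv (fun y => w y ^ 2) x) =ᵐ[unitMeasure]
      fun x => w x ^ 2 + 2 * (x * deriv w x * w x) := by
  filter_upwards [hw.ae_differentiableAt] with x hx
  rw [(hx.hasDerivAt.fun_pow 2).deriv]
  push_cast
  ring

lemma integrable_sq_add_id_mul_deriv_sq (ha : IsCoefficient a) (hw : MemV1 a w) :
    Integrable (fun x => w x ^ 2 + x * deriv (fun y => w y ^ 2) x) unitMeasure :=
  (integrable_congr hw.sq_add_id_mul_deriv_sq_ae).2 (hw.memLp.integrable_sq.add
    ((hw.integrable_id_mul_deriv_mul ha hw.memLp).const_mul 2))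

lemma tendsto_id_mul_sq (ha : IsCoefficient a) (hw : MemV1 a w) :
    Tendsto (fun x => x * w x ^ 2) (𝓝[>] 0) (𝓝 0) :=
  tendsto_id_mul_zero one_pos (LocallyACOnIoc.sq hw.locallyAC) hw.memLp.integrable_sq
    (hw.integrable_sq_add_id_mul_deriv_sq ha)

lemma two_mul_inner_radialMul_self (ha : IsCoefficient a) (hw : MemV1 a w) :
    2 * inner ℝ (ha.radialMul (toL2 (weightedDeriv a w))) (toL2 w) = w 1 ^ 2 - ‖toL2 w‖ ^ 2 := by
  have hparts := integral_add_id_mul_deriv one_pos (LocallyACOnIoc.sq hw.locallyAC)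
    hw.memLp.integrable_sq (hw.integrable_sq_add_id_mul_deriv_sq ha)
  rw [integral_congr_ae hw.sq_add_id_mul_deriv_sq_ae, integral_add hw.memLp.integrable_sq
    ((hw.integrable_id_mul_deriv_mul ha hw.memLp).const_mul 2), integral_const_mul,
    ← norm_toL2_sq hw.memLp, ← hw.inner_radialMul ha hw.memLp, one_mul] at hparts
  linarith

end MemV1

lemma MemH1.two_mul_inner_radialMul_self (ha : IsCoefficient a) (hv : MemH1 a v) :
    2 * inner ℝ (ha.radialMul (toL2 (weightedDeriv a v))) (toL2 v) = -‖toL2 v‖ ^ 2 := by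
  rw [hv.toMemV1.two_mul_inner_radialMul_self ha, hv.at_one]
  ring

end EnergySpace

section Flux

variable {w p v : ℝ → ℝ}

/-- `w ∈ V²_a(0,1)` together with the absolutely continuous representative `p` of its flux `a w'`.
The relation `w' = p / a` is imposed at every point of `(0,1]`, which gives a meaning to the trace
`w'(1)`. -/
structure IsFlux (a w p : ℝ → ℝ) : Prop extends MemV1 a w where
  ac : AbsolutelyContinuousOnInterval p 0 1
  memLp_deriv_flux : MemLp (deriv p) 2 unitMeasure
  hasDerivWithinAt : ∀ x ∈ Ioc (0 : ℝ) 1, HasDerivWithinAt w (p x / a x) (Icc 0 1) x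

lemma MemV2.exists_isFlux (ha : IsCoefficient a) (hw : MemV2 a w) : ∃ p, IsFlux a w p := by
  obtain ⟨p, hp, hp', hpw⟩ := hw.flux
  have hpc : ContinuousOn p (Icc 0 1) := uIcc_of_le zero_le_one (α := ℝ) ▸ hp.continuousOn
  have hae : ∀ᵐ x, x ∈ Ioo (0 : ℝ) 1 → deriv w x = p x / a x := by
    rw [← ae_restrict_iff' measurableSet_Ioo]
    filter_upwards [hpw, ae_restrict_mem measurableSet_Ioo] with x hx hx01
    rw [← hx, mul_div_cancel_left₀ _ (ha.pos_Ioo hx01).ne']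
  refine ⟨p, hw.toMemV1, hp, hp', fun x hx => ?_⟩
  have hε : x / 2 ∈ Ioo (0 : ℝ) 1 := ⟨half_pos hx.1, (half_lt_self hx.1).trans_le hx.2⟩
  have hsub : Icc (x / 2) 1 ⊆ Icc 0 1 := Icc_subset_Icc_left hε.1.le
  have hquot : ContinuousOn (fun y => p y / a y) (Icc (x / 2) 1) :=
    (hpc.mono hsub).div (ha.continuousOn.mono hsub)
      fun y hy => (ha.pos y ⟨hε.1.trans_le hy.1, hy.2⟩).ne'
  have hderiv := hasDerivWithinAt_Icc_of_ae_deriv_eq hε.2.le (hw.locallyAC _ hε) hquot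
    (hae.mono fun y hy hyε => hy ⟨hε.1.trans hyε.1, hyε.2⟩) ⟨half_le_self hx.1.le, hx.2⟩
  refine hderiv.mono_of_mem_nhdsWithin ?_
  filter_upwards [self_mem_nhdsWithin, nhdsWithin_le_nhds (Ici_mem_nhds (half_lt_self hx.1))]
    with y hy hyx using ⟨hyx, hy.2⟩

namespace IsFlux

lemma continuousOn (h : IsFlux a w p) : ContinuousOn p (Icc 0 1) :=
  uIcc_of_le zero_le_one (α := ℝ) ▸ h.ac.continuousOn

lemma locallyACOnIoc (h : IsFlux a w p) : LocallyACOnIoc p 0 1 := fun _ hx =>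
  h.ac.mono (uIcc_subset_uIcc_right (Icc_subset_uIcc (Ioo_subset_Icc_self hx)))

lemma mul_deriv_eq (ha : IsCoefficient a) (h : IsFlux a w p) {x : ℝ} (hx : x ∈ Ioo (0 : ℝ) 1) :
    a x * deriv w x = p x := by
  rw [((h.hasDerivWithinAt x (Ioo_subset_Ioc_self hx)).hasDerivAt
    (Icc_mem_nhds hx.1 hx.2)).deriv, mul_div_cancel₀ _ (ha.pos_Ioo hx).ne']

lemma memV2 (ha : IsCoefficient a) (h : IsFlux a w p) : MemV2 a w where
  toMemV1 := h.toMemV1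
  flux := ⟨p, h.ac, h.memLp_deriv_flux,
    (ae_restrict_mem measurableSet_Ioo).mono fun _ hx => h.mul_deriv_eq ha hx⟩

lemma degenOp_eq (ha : IsCoefficient a) (h : IsFlux a w p) {x : ℝ} (hx : x ∈ Ioo (0 : ℝ) 1) :
    degenOp a w x = deriv p x := by
  refine Filter.EventuallyEq.deriv_eq ?_
  filter_upwards [Ioo_mem_nhds hx.1 hx.2] with y hy using h.mul_deriv_eq ha hy

lemma degenOp_ae_eq (ha : IsCoefficient a) (h : IsFlux a w p) :
    degenOp a w =ᵐ[unitMeasure] deriv p :=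
  (ae_restrict_mem measurableSet_Ioo).mono fun _ hx => h.degenOp_eq ha hx

lemma memLp_degenOp (ha : IsCoefficient a) (h : IsFlux a w p) :
    MemLp (degenOp a w) 2 unitMeasure :=
  h.memLp_deriv_flux.ae_eq (h.degenOp_ae_eq ha).symm

lemma sqrt_mul_weightedDeriv (ha : IsCoefficient a) (h : IsFlux a w p) {x : ℝ}
    (hx : x ∈ Ioo (0 : ℝ) 1) : √(a x) * weightedDeriv a w x = p x := by
  rw [weightedDeriv, ← mul_assoc, Real.mul_self_sqrt (ha.pos_Ioo hx).le, h.mul_deriv_eq ha hx]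

lemma weightedDeriv_sq (ha : IsCoefficient a) (h : IsFlux a w p) {x : ℝ}
    (hx : x ∈ Ioo (0 : ℝ) 1) : weightedDeriv a w x ^ 2 = p x ^ 2 / a x := by
  rw [eq_div_iff (ha.pos_Ioo hx).ne', ← h.sqrt_mul_weightedDeriv ha hx, mul_pow,
    Real.sq_sqrt (ha.pos_Ioo hx).le, mul_comm]

lemma hasDerivWithinAt_one (h : IsFlux a w p) : HasDerivWithinAt w (p 1 / a 1) (Icc 0 1) 1 :=
  h.hasDerivWithinAt 1 (right_mem_Ioc.2 one_pos)

lemma derivWithin_one (h : IsFlux a w p) : derivWithin w (Icc 0 1) 1 = p 1 / a 1 :=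
  h.hasDerivWithinAt_one.derivWithin
    (uniqueDiffOn_Icc one_pos 1 (right_mem_Icc.2 zero_le_one))

lemma tendsto_zero (h : IsFlux a w p) : Tendsto p (𝓝[>] 0) (𝓝 (p 0)) := by
  rw [← nhdsWithin_Ioo_eq_nhdsGT one_pos]
  exact (h.continuousOn 0 (left_mem_Icc.2 zero_le_one)).mono_left
    (nhdsWithin_mono 0 Ioo_subset_Icc_self)

/- If `p 0 ≠ 0`, then `a w'² = p² / a` is at least of order `1 / x`, which is not integrable. -/
lemma zero_of_one_le_mu (ha : IsCoefficient a) (h : IsFlux a w p) (hmu : 1 ≤ mu a) : p 0 = 0 := by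
  by_contra hne
  have hinv : (fun x => x⁻¹) =O[𝓝[>] 0] fun x => (a x)⁻¹ := by
    refine (ha.isBigO_id_of_one_le_mu hmu).inv_rev ?_
    filter_upwards [Ioo_mem_nhdsGT one_pos] with x hx h0 using absurd h0 (ha.pos_Ioo hx).ne'
  have hp : (fun _ => (1 : ℝ)) =O[𝓝[>] 0] fun x => p x ^ 2 :=
    (Asymptotics.isBigO_const_const 1 (pow_ne_zero 2 hne) _).trans
      ((Asymptotics.isEquivalent_const_iff_tendsto (pow_ne_zero 2 hne)).2
        (h.tendsto_zero.pow 2)).isBigO_symm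
  refine not_integrableOn_of_inv_isBigO one_pos ?_ h.memLp_weightedDeriv.integrable_sq
  refine (hp.mul hinv).congr' (.of_forall fun x => one_mul _) ?_
  filter_upwards [Ioo_mem_nhdsGT one_pos] with x hx
  rw [h.weightedDeriv_sq ha hx, div_eq_mul_inv]

/- For `μ_a < 1` the factor `v` vanishes at `0`. For `μ_a ≥ 1` the flux does, so that `p² = O(x)`,
while `x v² → 0` for every `v ∈ V¹_a(0,1)`. -/
lemma tendsto_mul_zero (ha : IsCoefficient a) (h : IsFlux a w p) (hv : MemH1 a v) :
    Tendsto (fun x => v x * p x) (𝓝[>] 0) (𝓝 0) := by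
  rcases lt_or_ge (mu a) 1 with hmu | hmu
  · simpa only [zero_mul] using (hv.at_zero hmu).mul h.tendsto_zero
  · have hlim := ((hv.toMemV1.tendsto_id_mul_sq ha).mul_const
      (∫ t in Ioo 0 1, deriv p t ^ 2)).sqrt
    rw [zero_mul, Real.sqrt_zero] at hlim
    refine squeeze_zero_norm' ?_ hlim
    filter_upwards [Ioo_mem_nhdsGT one_pos] with x hx
    have hle := sq_le_mul_integral_deriv_sq h.ac h.memLp_deriv_flux (h.zero_of_one_le_mu ha hmu) hx
    rw [sub_zero] at hle
    refine Real.abs_le_sqrt ?_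
    rw [mul_pow, mul_comm x, mul_assoc]
    exact mul_le_mul_of_nonneg_left hle (sq_nonneg _)

lemma inner_add_inner_eq_zero (ha : IsCoefficient a) (h : IsFlux a w p) (hv : MemH1 a v) :
    inner ℝ (toL2 (weightedDeriv a v)) (toL2 (weightedDeriv a w)) +
      inner ℝ (toL2 v) (toL2 (degenOp a w)) = 0 := by
  have hint₁ : Integrable (fun x => weightedDeriv a v x * weightedDeriv a w x) unitMeasure :=
    hv.memLp_weightedDeriv.integrable_mul h.memLp_weightedDeriv
  have hint₂ : Integrable (fun x => v x * degenOp a w x) unitMeasure :=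
    hv.memLp.integrable_mul (h.memLp_degenOp ha)
  have hcongr : (fun x => weightedDeriv a v x * weightedDeriv a w x + v x * degenOp a w x)
      =ᵐ[unitMeasure] fun x => deriv v x * p x + v x * deriv p x := by
    filter_upwards [ae_restrict_mem measurableSet_Ioo] with x hx
    rw [h.degenOp_eq ha hx, ← h.sqrt_mul_weightedDeriv ha hx, weightedDeriv]
    ring
  have hlim := tendsto_mul_of_integrableOn_deriv one_pos hv.locallyAC h.locallyACOnIoc
    ((integrable_congr hcongr).1 (hint₁.add hint₂))
  have hzero := tendsto_nhds_unique hlim (h.tendsto_mul_zero ha hv)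
  rw [inner_toL2 hv.memLp_weightedDeriv h.memLp_weightedDeriv,
    inner_toL2 hv.memLp (h.memLp_degenOp ha), ← integral_add hint₁ hint₂,
    integral_congr_ae hcongr]
  rw [hv.at_one, zero_mul, zero_sub, neg_eq_zero] at hzero
  exact hzero

lemma sq_div_add_id_mul_deriv_ae (ha : IsCoefficient a) (h : IsFlux a w p) :
    (fun x => p x ^ 2 / a x + x * deriv (fun y => p y ^ 2 / a y) x) =ᵐ[unitMeasure]
      fun x => 2 * (x * deriv w x * degenOp a w x) +
        (a x - x * coeffDeriv a x) * deriv w x ^ 2 := by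
  filter_upwards [ae_restrict_mem measurableSet_Ioo,
    h.locallyACOnIoc.ae_differentiableAt one_pos] with x hx hpx
  have hax := (ha.pos_Ioo hx).ne'
  rw [((hpx.hasDerivAt.fun_pow 2).fun_div (ha.hasDerivAt hx) hax).deriv, h.degenOp_eq ha hx,
    ← h.mul_deriv_eq ha hx]
  field_simp
  ring

lemma two_mul_inner_radialMul (ha : IsCoefficient a) (h : IsFlux a w p) :
    2 * inner ℝ (ha.radialMul (toL2 (weightedDeriv a w))) (toL2 (degenOp a w)) =
      a 1 * derivWithin w (Icc 0 1) 1 ^ 2 -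
        inner ℝ (ha.defectMul (toL2 (weightedDeriv a w))) (toL2 (weightedDeriv a w)) := by
  have hac : LocallyACOnIoc (fun x => p x ^ 2 / a x) 0 1 := fun ε hε => by
    simpa only [div_eq_mul_inv] using
      (h.locallyACOnIoc.sq ε hε).fun_mul (ha.absolutelyContinuousOnInterval_inv hε)
  have hint : IntegrableOn (fun x => p x ^ 2 / a x) (Ioo 0 1) :=
    h.memLp_weightedDeriv.integrable_sq.congr
      ((ae_restrict_mem measurableSet_Ioo).mono fun _ hx => h.weightedDeriv_sq ha hx)
  have hint₁ : Integrable (fun x => 2 * (x * deriv w x * degenOp a w x)) unitMeasure :=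
    (h.integrable_id_mul_deriv_mul ha (h.memLp_degenOp ha)).const_mul 2
  have hint₂ := h.integrable_defect ha
  have hparts := integral_add_id_mul_deriv one_pos hac hint
    ((integrable_congr (h.sq_div_add_id_mul_deriv_ae ha)).2 (hint₁.add hint₂))
  rw [integral_congr_ae (h.sq_div_add_id_mul_deriv_ae ha), integral_add hint₁ hint₂,
    integral_const_mul, ← h.inner_radialMul ha (h.memLp_degenOp ha), ← h.inner_defectMul ha,
    one_mul] at hparts
  have htrace : a 1 * derivWithin w (Icc 0 1) 1 ^ 2 = p 1 ^ 2 / a 1 := by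
    rw [h.derivWithin_one]
    field_simp [ha.pos_one.ne']
  linarith

lemma mul_derivWithin_one (ha : IsCoefficient a) (h : IsFlux a w p) :
    a 1 * derivWithin w (Icc 0 1) 1 = inner ℝ (toL2 id) (toL2 (degenOp a w)) +
      inner ℝ (toL2 fun x => √(a x)) (toL2 (weightedDeriv a w)) := by
  have hid : MemLp (id : ℝ → ℝ) 2 unitMeasure :=
    memLp_unitMeasure_of_continuousOn_Icc continuousOn_id
  have hint : Integrable p unitMeasure :=
    (h.continuousOn.integrableOn_compact isCompact_Icc).mono_set Ioo_subset_Icc_self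
  have hint' : Integrable (fun x => x * deriv p x) unitMeasure :=
    hid.integrable_mul h.memLp_deriv_flux
  have hparts := integral_add_id_mul_deriv one_pos h.locallyACOnIoc hint (hint.add hint')
  rw [integral_add hint hint', one_mul] at hparts
  rw [toL2_congr (h.degenOp_ae_eq ha), inner_toL2 hid h.memLp_deriv_flux,
    inner_toL2 ha.memLp_sqrt h.memLp_weightedDeriv, h.derivWithin_one,
    mul_div_cancel₀ _ ha.pos_one.ne', ← hparts, add_comm]
  congr 1
  exact setIntegral_congr_fun measurableSet_Ioo fun x hx =>
    (h.sqrt_mul_weightedDeriv ha hx).symm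

end IsFlux

end Flux

section LinearStructure

variable {f g p q w : ℝ → ℝ}

lemma weightedDeriv_const_smul (a : ℝ → ℝ) (c : ℝ) (f : ℝ → ℝ) :
    weightedDeriv a (c • f) = c • weightedDeriv a f := by
  ext x
  simp only [weightedDeriv, deriv_const_smul_field, Pi.smul_apply, smul_eq_mul]
  ring

lemma degenOp_const_smul (a : ℝ → ℝ) (c : ℝ) (f : ℝ → ℝ) :
    degenOp a (c • f) = c • degenOp a f := by
  ext x
  simp only [degenOp, deriv_const_smul_field, Pi.smul_apply, smul_eq_mul, mul_left_comm _ c,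
    deriv_const_mul_field']

lemma MemV1.weightedDeriv_sub_ae (hf : MemV1 a f) (hg : MemV1 a g) :
    weightedDeriv a (f - g) =ᵐ[unitMeasure] weightedDeriv a f - weightedDeriv a g := by
  filter_upwards [hf.ae_differentiableAt, hg.ae_differentiableAt] with x hfx hgx
  simp only [weightedDeriv, Pi.sub_apply, deriv_sub hfx hgx, mul_sub]

lemma MemV1.toL2_weightedDeriv_sub (hf : MemV1 a f) (hg : MemV1 a g) :
    toL2 (weightedDeriv a (f - g)) = toL2 (weightedDeriv a f) - toL2 (weightedDeriv a g) := by
  rw [toL2_congr (hf.weightedDeriv_sub_ae hg),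
    toL2_sub hf.memLp_weightedDeriv hg.memLp_weightedDeriv]

lemma MemV1.sub (hf : MemV1 a f) (hg : MemV1 a g) : MemV1 a (f - g) where
  memLp := hf.memLp.sub hg.memLp
  locallyAC ε hε := (hf.locallyAC ε hε).sub (hg.locallyAC ε hε)
  memLp_weightedDeriv := (hf.memLp_weightedDeriv.sub hg.memLp_weightedDeriv).ae_eq
    (hf.weightedDeriv_sub_ae hg).symm

lemma MemV1.const_smul (c : ℝ) (hf : MemV1 a f) : MemV1 a (c • f) where
  memLp := hf.memLp.const_smul c
  locallyAC ε hε := (hf.locallyAC ε hε).const_smul c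
  memLp_weightedDeriv := by
    rw [weightedDeriv_const_smul]
    exact hf.memLp_weightedDeriv.const_smul c

lemma MemH1.sub (hf : MemH1 a f) (hg : MemH1 a g) : MemH1 a (f - g) where
  toMemV1 := hf.toMemV1.sub hg.toMemV1
  at_one := by rw [Pi.sub_apply, hf.at_one, hg.at_one, sub_zero]
  at_zero hmu := by simpa only [sub_zero] using! (hf.at_zero hmu).sub (hg.at_zero hmu)

lemma MemH1.const_smul (c : ℝ) (hf : MemH1 a f) : MemH1 a (c • f) where
  toMemV1 := hf.toMemV1.const_smul c
  at_one := by rw [Pi.smul_apply, hf.at_one, smul_zero]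
  at_zero hmu := by simpa only [smul_zero] using! (hf.at_zero hmu).const_smul c

lemma IsFlux.deriv_sub_ae (hf : IsFlux a f p) (hg : IsFlux a g q) :
    deriv (p - q) =ᵐ[unitMeasure] deriv p - deriv q := by
  filter_upwards [hf.locallyACOnIoc.ae_differentiableAt one_pos,
    hg.locallyACOnIoc.ae_differentiableAt one_pos] with x hpx hqx using deriv_sub hpx hqx

lemma IsFlux.sub (hf : IsFlux a f p) (hg : IsFlux a g q) : IsFlux a (f - g) (p - q) where
  toMemV1 := hf.toMemV1.sub hg.toMemV1
  ac := hf.ac.sub hg.ac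
  memLp_deriv_flux := (hf.memLp_deriv_flux.sub hg.memLp_deriv_flux).ae_eq
    (hf.deriv_sub_ae hg).symm
  hasDerivWithinAt x hx := by
    rw [Pi.sub_apply, sub_div]
    exact (hf.hasDerivWithinAt x hx).sub (hg.hasDerivWithinAt x hx)

namespace MemV2

lemma memLp_degenOp (ha : IsCoefficient a) (hw : MemV2 a w) : MemLp (degenOp a w) 2 unitMeasure :=
  let ⟨_, h⟩ := hw.exists_isFlux ha
  h.memLp_degenOp ha

lemma sub (ha : IsCoefficient a) (hf : MemV2 a f) (hg : MemV2 a g) : MemV2 a (f - g) :=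
  let ⟨_, hp⟩ := hf.exists_isFlux ha
  let ⟨_, hq⟩ := hg.exists_isFlux ha
  (hp.sub hq).memV2 ha

lemma const_smul (c : ℝ) (hf : MemV2 a f) : MemV2 a (c • f) where
  toMemV1 := hf.toMemV1.const_smul c
  flux := by
    obtain ⟨p, hp, hp', hfp⟩ := hf.flux
    refine ⟨c • p, hp.const_smul c, ?_, ?_⟩
    · rw [show deriv (c • p) = c • deriv p from funext fun x => deriv_const_smul_field ..]
      exact hp'.const_smul c
    · filter_upwards [hfp] with x hx
      rw [deriv_const_smul_field, Pi.smul_apply, ← hx, mul_smul_comm]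

lemma toL2_degenOp_sub (ha : IsCoefficient a) (hf : MemV2 a f) (hg : MemV2 a g) :
    toL2 (degenOp a (f - g)) = toL2 (degenOp a f) - toL2 (degenOp a g) := by
  obtain ⟨p, hp⟩ := hf.exists_isFlux ha
  obtain ⟨q, hq⟩ := hg.exists_isFlux ha
  rw [toL2_congr ((hp.sub hq).degenOp_ae_eq ha), toL2_congr (hp.deriv_sub_ae hq),
    toL2_sub hp.memLp_deriv_flux hq.memLp_deriv_flux, toL2_congr (hp.degenOp_ae_eq ha),
    toL2_congr (hq.degenOp_ae_eq ha)]

lemma derivWithin_sub_one (ha : IsCoefficient a) (hf : MemV2 a f) (hg : MemV2 a g) :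
    derivWithin (f - g) (Icc 0 1) 1 = derivWithin f (Icc 0 1) 1 - derivWithin g (Icc 0 1) 1 := by
  obtain ⟨p, hp⟩ := hf.exists_isFlux ha
  obtain ⟨q, hq⟩ := hg.exists_isFlux ha
  rw [(hp.sub hq).derivWithin_one, hp.derivWithin_one, hq.derivWithin_one, Pi.sub_apply, sub_div]

end MemV2

lemma MemH2.sub (ha : IsCoefficient a) (hf : MemH2 a f) (hg : MemH2 a g) : MemH2 a (f - g) :=
  ⟨hf.1.sub ha hg.1, hf.2.sub hg.2⟩

lemma MemH2.const_smul (c : ℝ) (hf : MemH2 a f) : MemH2 a (c • f) :=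
  ⟨hf.1.const_smul c, hf.2.const_smul c⟩

end LinearStructure

section WeakCharacterization

variable {f w ψ : ℝ → ℝ}

lemma memLp_div_sqrt (ha : IsCoefficient a) (hψ : Continuous ψ) (hs : tsupport ψ ⊆ Ioo 0 1) :
    MemLp (fun x => ψ x / √(a x)) 2 unitMeasure := by
  have hcont : ContinuousOn (fun x => ψ x / √(a x)) (Ioo 0 1) :=
    hψ.continuousOn.div ha.continuousOn_sqrt fun x hx => (ha.sqrt_pos hx).ne'
  have hcompact : IsCompact (tsupport ψ) :=
    isCompact_Icc.of_isClosed_subset (isClosed_tsupport ψ) (hs.trans Ioo_subset_Icc_self)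
  obtain ⟨C, hC⟩ := hcompact.exists_bound_of_continuousOn (hcont.mono hs)
  refine MemLp.of_bound (hcont.aestronglyMeasurable measurableSet_Ioo) (max C 0)
    (.of_forall fun x => ?_)
  by_cases hx : x ∈ tsupport ψ
  · exact (hC x hx).trans (le_max_left C 0)
  · rw [image_eq_zero_of_notMem_tsupport hx, zero_div, norm_zero]
    exact le_max_right C 0

namespace MemV1

lemma inner_div_sqrt_add_inner_deriv (ha : IsCoefficient a) (hw : MemV1 a w)
    (hψ : ContDiff ℝ 1 ψ) (hs : tsupport ψ ⊆ Ioo 0 1) :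
    inner ℝ (toL2 fun x => ψ x / √(a x)) (toL2 (weightedDeriv a w)) +
      inner ℝ (toL2 (deriv ψ)) (toL2 w) = 0 := by
  have hψa := memLp_div_sqrt ha hψ.continuous hs
  have hψ' := memLp_unitMeasure_of_continuousOn_Icc (hψ.continuous_deriv le_rfl).continuousOn
  have hint₁ : Integrable (fun x => ψ x / √(a x) * weightedDeriv a w x) unitMeasure :=
    hψa.integrable_mul hw.memLp_weightedDeriv
  have hint₂ : Integrable (fun x => deriv ψ x * w x) unitMeasure := hψ'.integrable_mul hw.memLp
  have hcongr : (fun x => ψ x / √(a x) * weightedDeriv a w x + deriv ψ x * w x)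
      =ᵐ[unitMeasure] fun x => deriv ψ x * w x + ψ x * deriv w x := by
    filter_upwards [ae_restrict_mem measurableSet_Ioo] with x hx
    rw [weightedDeriv, ← mul_assoc, div_mul_cancel₀ _ (ha.sqrt_pos hx).ne', add_comm]
  have hlim := tendsto_mul_of_integrableOn_deriv one_pos
    (fun _ _ => hψ.contDiffOn.absolutelyContinuousOnInterval) hw.locallyAC
    ((integrable_congr hcongr).1 (hint₁.add hint₂))
  have hzero : (fun x => ψ x * w x) =ᶠ[𝓝[>] 0] fun _ => 0 := by
    filter_upwards [nhdsWithin_le_nhds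
      (notMem_tsupport_iff_eventuallyEq.1 fun h => lt_irrefl (0 : ℝ) (hs h).1)] with x hx
    rw [hx, Pi.zero_apply, zero_mul]
  have hone : ψ 1 = 0 := image_eq_zero_of_notMem_tsupport fun h => lt_irrefl (1 : ℝ) (hs h).2
  have hsum := tendsto_nhds_unique (tendsto_const_nhds.congr' hzero.symm) hlim
  rw [hone, zero_mul, zero_sub, zero_eq_neg] at hsum
  rw [inner_toL2 hψa hw.memLp_weightedDeriv, inner_toL2 hψ' hw.memLp, ← integral_add hint₁ hint₂,
    integral_congr_ae hcongr, hsum]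

end MemV1

lemma eq_zero_of_forall_inner_div_sqrt_eq_zero (ha : IsCoefficient a) {G : L2}
    (hG : ∀ ψ : ℝ → ℝ, ContDiff ℝ 1 ψ → tsupport ψ ⊆ Ioo 0 1 →
      inner ℝ (toL2 fun x => ψ x / √(a x)) G = 0) : G = 0 := by
  have hloc : LocallyIntegrableOn (fun x => G x * (√(a x))⁻¹) (Ioo 0 1) :=
    (IntegrableOn.locallyIntegrableOn ((Lp.memLp G).integrable one_le_two)).mul_continuousOn
      (ha.continuousOn_sqrt.inv₀ fun x hx => (ha.sqrt_pos hx).ne') isOpen_Ioo.isLocallyClosed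
  have hzero := isOpen_Ioo.ae_eq_zero_of_integral_contDiff_smul_eq_zero hloc fun ψ hψ _ hs => by
    have hψ₁ : ContDiff ℝ 1 ψ := hψ.of_le (mod_cast le_top)
    rw [← hG ψ hψ₁ hs, ← toL2_coeFn G,
      inner_toL2 (memLp_div_sqrt ha hψ₁.continuous hs) (Lp.memLp G),
      ← setIntegral_eq_integral_of_forall_compl_eq_zero (s := Ioo 0 1)]
    · refine integral_congr_ae (.of_forall fun x => ?_)
      simp only [toL2_coeFn, smul_eq_mul]
      ring
    · intro x hx
      rw [image_eq_zero_of_notMem_tsupport fun h => hx (hs h), zero_smul]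
  refine Lp.eq_zero_iff_ae_eq_zero.2 ?_
  rw [← ae_restrict_iff' measurableSet_Ioo] at hzero
  filter_upwards [hzero, ae_restrict_mem measurableSet_Ioo] with x hx hx01
  exact (mul_eq_zero.1 hx).resolve_right (inv_ne_zero (ha.sqrt_pos hx01).ne')

namespace MemV1

lemma toL2_weightedDeriv_eq_of_weak (ha : IsCoefficient a) (hw : MemV1 a w) {G : L2}
    (hG : ∀ ψ : ℝ → ℝ, ContDiff ℝ 1 ψ → tsupport ψ ⊆ Ioo 0 1 →
      inner ℝ (toL2 fun x => ψ x / √(a x)) G + inner ℝ (toL2 (deriv ψ)) (toL2 w) = 0) :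
    toL2 (weightedDeriv a w) = G := by
  refine sub_eq_zero.1 (eq_zero_of_forall_inner_div_sqrt_eq_zero ha fun ψ hψ hs => ?_)
  rw [inner_sub_right]
  linarith [hG ψ hψ hs, hw.inner_div_sqrt_add_inner_deriv ha hψ hs]

lemma toL2_weightedDeriv_congr (ha : IsCoefficient a) (hf : MemV1 a f) (hw : MemV1 a w)
    (h : toL2 f = toL2 w) : toL2 (weightedDeriv a f) = toL2 (weightedDeriv a w) :=
  hf.toL2_weightedDeriv_eq_of_weak ha fun ψ hψ hs => by
    rw [h]
    exact hw.inner_div_sqrt_add_inner_deriv ha hψ hs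

lemma toL2_weightedDeriv_eq_integral (ha : IsCoefficient a) {u : ℝ → ℝ → ℝ} {t : ℝ} (ht : 0 ≤ t)
    (hu : ∀ s, 0 ≤ s → MemV1 a (u s)) (hcont : ContinuousOn (fun s => toL2 (u s)) (Ici 0))
    (hcont' : ContinuousOn (fun s => toL2 (weightedDeriv a (u s))) (Ici 0)) (hw : MemV1 a w)
    (hint : toL2 w = ∫ s in (0 : ℝ)..t, toL2 (u s)) :
    toL2 (weightedDeriv a w) = ∫ s in (0 : ℝ)..t, toL2 (weightedDeriv a (u s)) := by
  have hsub : uIcc 0 t ⊆ Ici 0 := uIcc_of_le ht ▸ Icc_subset_Ici_self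
  have hinner (χ : L2) {F : ℝ → L2} (hF : ContinuousOn F (Ici 0)) :
      inner ℝ χ (∫ s in (0 : ℝ)..t, F s) = ∫ s in (0 : ℝ)..t, inner ℝ χ (F s) :=
    ((innerSL ℝ χ).intervalIntegral_comp_comm (hF.mono hsub).intervalIntegrable).symm
  have hinnerInt (χ : L2) {F : ℝ → L2} (hF : ContinuousOn F (Ici 0)) :
      IntervalIntegrable (fun s => inner ℝ χ (F s)) volume 0 t :=
    (continuousOn_const.inner (hF.mono hsub)).intervalIntegrable
  refine hw.toL2_weightedDeriv_eq_of_weak ha fun ψ hψ hs => ?_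
  rw [hint, hinner _ hcont, hinner _ hcont',
    ← intervalIntegral.integral_add (hinnerInt _ hcont') (hinnerInt _ hcont)]
  exact intervalIntegral.integral_zero_ae (.of_forall fun s hs₀ =>
    (hu s (hsub (uIoc_subset_uIcc hs₀))).inner_div_sqrt_add_inner_deriv ha hψ hs)

end MemV1

end WeakCharacterization

section EnergyState

variable {f g v w : ℝ → ℝ}

/-- The Hilbert space `L²(0,1) × L²(0,1)` in which the energy space `H¹_a(0,1) × L²(0,1)` embeds
isometrically by `(w, v) ↦ (√a w', v)`. -/
abbrev EnergyState : Type := WithLp 2 (L2 × L2)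

/-- The image `(√a w', v)` of the state `(w, v)`. -/
def energyState (a w v : ℝ → ℝ) : EnergyState := WithLp.toLp 2 (toL2 (weightedDeriv a w), toL2 v)

lemma EnergyState.ext {U V : EnergyState} (h₁ : U.fst = V.fst) (h₂ : U.snd = V.snd) : U = V :=
  WithLp.ofLp_injective 2 (Prod.ext h₁ h₂)

lemma energyState_sub (hf : MemV1 a f) (hg : MemV1 a g) (hv : MemLp v 2 unitMeasure)
    (hw : MemLp w 2 unitMeasure) :
    energyState a (f - g) (v - w) = energyState a f v - energyState a g w :=
  EnergyState.ext (hf.toL2_weightedDeriv_sub hg) (toL2_sub hv hw)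

lemma energyState_const_smul (c : ℝ) (hf : MemV1 a f) (hv : MemLp v 2 unitMeasure) :
    energyState a (c • f) (c • v) = c • energyState a f v := by
  refine EnergyState.ext ?_ (toL2_const_smul c hv)
  exact (congrArg toL2 (weightedDeriv_const_smul a c f)).trans
    (toL2_const_smul c hf.memLp_weightedDeriv)

lemma energyState_diffQuot {u ut : ℝ → ℝ → ℝ} {h t : ℝ} (hu : MemV1 a (u t))
    (hu' : MemV1 a (u (t + h))) (hut : MemLp (ut t) 2 unitMeasure)
    (hut' : MemLp (ut (t + h)) 2 unitMeasure) :
    energyState a (diffQuot h u t) (diffQuot h ut t) =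
      diffQuot h (fun s => energyState a (u s) (ut s)) t := by
  rw [diffQuot, diffQuot, energyState_const_smul _ (hu'.sub hu) (hut'.sub hut),
    energyState_sub hu' hu hut' hut, diffQuot]

lemma norm_energyState_sq (hf : MemV1 a f) (hv : MemLp v 2 unitMeasure) :
    ‖energyState a f v‖ ^ 2 =
      ∫ x, weightedDeriv a f x ^ 2 ∂unitMeasure + ∫ x, v x ^ 2 ∂unitMeasure := by
  rw [WithLp.prod_norm_sq_eq_of_L2, ← norm_toL2_sq hf.memLp_weightedDeriv, ← norm_toL2_sq hv]
  rfl

namespace IsCoefficient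

/-- The quadratic form `∫ (v² + (a - x a') (w')²)` on states `(√a w', v)`. -/
def bulkForm (ha : IsCoefficient a) (U : EnergyState) : ℝ :=
  ‖U.snd‖ ^ 2 + inner ℝ (ha.defectMul U.fst) U.fst

/-- The quadratic form `∫ x w' v` on states `(√a w', v)`. -/
def crossForm (ha : IsCoefficient a) (U : EnergyState) : ℝ :=
  inner ℝ (ha.radialMul U.fst) U.snd

lemma continuous_bulkForm (ha : IsCoefficient a) : Continuous ha.bulkForm :=
  ((WithLp.continuous_snd ..).norm.pow 2).add
    ((ha.defectMul.continuous.comp (WithLp.continuous_fst ..)).inner (WithLp.continuous_fst ..))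

lemma continuous_crossForm (ha : IsCoefficient a) : Continuous ha.crossForm :=
  (ha.radialMul.continuous.comp (WithLp.continuous_fst ..)).inner (WithLp.continuous_snd ..)

lemma abs_bulkForm_le (ha : IsCoefficient a) (U : EnergyState) :
    |ha.bulkForm U| ≤ 3 * ‖U‖ ^ 2 := by
  have hinner : |inner ℝ (ha.defectMul U.fst) U.fst| ≤ 3 * ‖U.fst‖ * ‖U.fst‖ :=
    (abs_real_inner_le_norm _ _).trans
      (mul_le_mul_of_nonneg_right (ha.norm_defectMul_apply_le _) (norm_nonneg _))
  refine (abs_add_le _ _).trans ?_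
  rw [abs_of_nonneg (sq_nonneg _), WithLp.prod_norm_sq_eq_of_L2]
  linarith [sq_nonneg ‖U.snd‖]

lemma two_mul_abs_crossForm_le (ha : IsCoefficient a) (U : EnergyState) :
    2 * |ha.crossForm U| ≤ 1 / √(a 1) * ‖U‖ ^ 2 := by
  have hinner : |ha.crossForm U| ≤ 1 / √(a 1) * ‖U.fst‖ * ‖U.snd‖ :=
    (abs_real_inner_le_norm _ _).trans
      (mul_le_mul_of_nonneg_right (ha.norm_radialMul_apply_le _) (norm_nonneg _))
  calc 2 * |ha.crossForm U| ≤ 1 / √(a 1) * (2 * ‖U.fst‖ * ‖U.snd‖) := by linarith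
    _ ≤ 1 / √(a 1) * ‖U‖ ^ 2 := by
      rw [WithLp.prod_norm_sq_eq_of_L2]
      gcongr
      exact two_mul_le_add_sq _ _

/-- The right-hand side `∫₀ᵀ ∫ (u_t² + (a - x a') u_x²) + 2 [∫ x u_x u_t]₀ᵀ` of the multiplier
identity, for a curve `U = (√a u_x, u_t)`. -/
def multiplierForm (ha : IsCoefficient a) (U : ℝ → EnergyState) (T : ℝ) : ℝ :=
  (∫ t in (0 : ℝ)..T, ha.bulkForm (U t)) + 2 * (ha.crossForm (U T) - ha.crossForm (U 0))

lemma multiplierForm_le (ha : IsCoefficient a) {U : ℝ → EnergyState}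
    (hU : ∀ t, 0 ≤ t → ‖U t‖ = ‖U 0‖) {T : ℝ} (hT : 0 ≤ T) :
    ha.multiplierForm U T ≤ (3 * T + 2 / √(a 1)) * ‖U 0‖ ^ 2 := by
  have hbulk : ‖∫ t in (0 : ℝ)..T, ha.bulkForm (U t)‖ ≤ 3 * ‖U 0‖ ^ 2 * |T - 0| := by
    refine intervalIntegral.norm_integral_le_of_norm_le_const fun t ht => ?_
    rw [uIoc_of_le hT] at ht
    exact hU t ht.1.le ▸ ha.abs_bulkForm_le (U t)
  rw [sub_zero, abs_of_nonneg hT] at hbulk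
  have hcrossT := hU T hT ▸ ha.two_mul_abs_crossForm_le (U T)
  have hcross₀ := ha.two_mul_abs_crossForm_le (U 0)
  calc ha.multiplierForm U T
      ≤ 3 * ‖U 0‖ ^ 2 * T + (1 / √(a 1) * ‖U 0‖ ^ 2 + 1 / √(a 1) * ‖U 0‖ ^ 2) := by
        rw [multiplierForm]
        linarith [(le_abs_self _).trans hbulk, le_abs_self (ha.crossForm (U T)),
          neg_abs_le (ha.crossForm (U 0))]
    _ = (3 * T + 2 / √(a 1)) * ‖U 0‖ ^ 2 := by ring

lemma tendsto_multiplierForm (ha : IsCoefficient a) {U : ℕ → ℝ → EnergyState}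
    {V : ℝ → EnergyState} (hcont : ∀ n, ContinuousOn (U n) (Ici 0))
    (hnorm : ∀ n t, 0 ≤ t → ‖U n t‖ = ‖U n 0‖)
    (hlim : ∀ t, 0 ≤ t → Tendsto (fun n => U n t) atTop (𝓝 (V t))) {T : ℝ} (hT : 0 ≤ T) :
    Tendsto (fun n => ha.multiplierForm (U n) T) atTop (𝓝 (ha.multiplierForm V T)) := by
  have hsub : uIoc 0 T ⊆ Ici 0 := uIoc_of_le hT ▸ fun t ht => ht.1.le
  have hcross {t : ℝ} (ht : 0 ≤ t) :
      Tendsto (fun n => ha.crossForm (U n t)) atTop (𝓝 (ha.crossForm (V t))) :=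
    (ha.continuous_crossForm.tendsto _).comp (hlim t ht)
  have hbound : ∀ᶠ n in atTop, ‖U n 0‖ ≤ ‖V 0‖ + 1 :=
    (hlim 0 le_rfl).norm.eventually_le_const (lt_add_one _)
  refine Tendsto.add ?_ (((hcross hT).sub (hcross le_rfl)).const_mul 2)
  refine intervalIntegral.tendsto_integral_filter_of_dominated_convergence
    (fun _ => 3 * (‖V 0‖ + 1) ^ 2) (.of_forall fun n => ?_) (hbound.mono fun n hn => ?_)
    intervalIntegrable_const (.of_forall fun t ht => ?_)
  · exact (ha.continuous_bulkForm.comp_continuousOn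
      ((hcont n).mono hsub)).aestronglyMeasurable measurableSet_uIoc
  · refine .of_forall fun t ht => (ha.abs_bulkForm_le _).trans ?_
    rw [hnorm n t (hsub ht)]
    gcongr
  · exact (ha.continuous_bulkForm.tendsto _).comp (hlim t (hsub ht))

end IsCoefficient

lemma MemV1.bulkForm_energyState (ha : IsCoefficient a) (hw : MemV1 a w)
    (hv : MemLp v 2 unitMeasure) :
    ha.bulkForm (energyState a w v) =
      ∫ x in (0 : ℝ)..1, (v x ^ 2 + (a x - x * coeffDeriv a x) * deriv w x ^ 2) := by
  rw [intervalIntegral.integral_of_le zero_le_one, integral_Ioc_eq_integral_Ioo,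
    integral_add hv.integrable_sq (hw.integrable_defect ha), ← norm_toL2_sq hv,
    ← hw.inner_defectMul ha]
  rfl

lemma MemV1.crossForm_energyState (ha : IsCoefficient a) (hw : MemV1 a w)
    (hv : MemLp v 2 unitMeasure) :
    ha.crossForm (energyState a w v) = ∫ x in (0 : ℝ)..1, x * deriv w x * v x := by
  rw [intervalIntegral.integral_of_le zero_le_one, integral_Ioc_eq_integral_Ioo,
    ← hw.inner_radialMul ha hv]
  rfl

end EnergyState

section ClassicalSolutions

variable {u ut v vt : ℝ → ℝ → ℝ}

/-- The trajectory `t ↦ (√a u_x(t,·), u_t(t,·))` of a solution. -/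
def trajectory (a : ℝ → ℝ) (u ut : ℝ → ℝ → ℝ) (t : ℝ) : EnergyState := energyState a (u t) (ut t)

namespace IsClassicalSolution

lemma of_hasDerivWithinAt_trajectory (hmem : ∀ t, 0 ≤ t → MemH2 a (u t))
    (hmem' : ∀ t, 0 ≤ t → MemH1 a (ut t))
    (hderiv : ∀ t, 0 ≤ t → HasDerivWithinAt (fun s => toL2 (u s)) (toL2 (ut t)) (Ici 0) t)
    (hderiv' : ∀ t, 0 ≤ t → HasDerivWithinAt (trajectory a u ut)
      (energyState a (ut t) (degenOp a (u t))) (Ici 0) t)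
    (hcont : ContinuousOn (fun t => energyState a (ut t) (degenOp a (u t))) (Ici 0)) :
    IsClassicalSolution a u ut where
  mem_left := hmem
  mem_right := hmem'
  deriv_u := hderiv
  deriv_ux t ht :=
    (WithLp.fstL 2 ℝ L2 L2).hasFDerivAt.comp_hasDerivWithinAt t (hderiv' t ht)
  deriv_ut t ht :=
    (WithLp.sndL 2 ℝ L2 L2).hasFDerivAt.comp_hasDerivWithinAt t (hderiv' t ht)
  continuousOn_utx := (WithLp.continuous_fst ..).comp_continuousOn hcont
  continuousOn_utt := (WithLp.continuous_snd ..).comp_continuousOn hcont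

lemma hasDerivWithinAt_trajectory (hu : IsClassicalSolution a u ut) {t : ℝ} (ht : 0 ≤ t) :
    HasDerivWithinAt (trajectory a u ut) (energyState a (ut t) (degenOp a (u t))) (Ici 0) t :=
  (WithLp.prodContinuousLinearEquiv 2 ℝ L2 L2).symm.hasFDerivAt.comp_hasDerivWithinAt t
    ((hu.deriv_ux t ht).prodMk (hu.deriv_ut t ht))

lemma continuousOn_deriv_trajectory (hu : IsClassicalSolution a u ut) :
    ContinuousOn (fun t => energyState a (ut t) (degenOp a (u t))) (Ici 0) :=
  (WithLp.prod_continuous_toLp 2 L2 L2).comp_continuousOn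
    (hu.continuousOn_utx.prodMk hu.continuousOn_utt)

lemma continuousOn_trajectory (hu : IsClassicalSolution a u ut) :
    ContinuousOn (trajectory a u ut) (Ici 0) :=
  fun _ ht => (hu.hasDerivWithinAt_trajectory ht).continuousWithinAt

lemma trajectory_sub (hu : IsClassicalSolution a u ut) (hv : IsClassicalSolution a v vt) {t : ℝ}
    (ht : 0 ≤ t) :
    trajectory a (u - v) (ut - vt) t = trajectory a u ut t - trajectory a v vt t :=
  energyState_sub (hu.mem_left t ht).2.toMemV1 (hv.mem_left t ht).2.toMemV1
    (hu.mem_right t ht).memLp (hv.mem_right t ht).memLp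

lemma sub (ha : IsCoefficient a) (hu : IsClassicalSolution a u ut)
    (hv : IsClassicalSolution a v vt) : IsClassicalSolution a (u - v) (ut - vt) := by
  have hvelocity {t : ℝ} (ht : 0 ≤ t) :
      energyState a (ut t - vt t) (degenOp a (u t - v t)) =
        energyState a (ut t) (degenOp a (u t)) - energyState a (vt t) (degenOp a (v t)) :=
    EnergyState.ext
      ((hu.mem_right t ht).toMemV1.toL2_weightedDeriv_sub (hv.mem_right t ht).toMemV1)
      ((hu.mem_left t ht).1.toL2_degenOp_sub ha (hv.mem_left t ht).1)
  refine .of_hasDerivWithinAt_trajectory (fun t ht => (hu.mem_left t ht).sub ha (hv.mem_left t ht))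
    (fun t ht => (hu.mem_right t ht).sub (hv.mem_right t ht)) (fun t ht => ?_) (fun t ht => ?_) ?_
  · rw [Pi.sub_apply, toL2_sub (hu.mem_right t ht).memLp (hv.mem_right t ht).memLp]
    exact ((hu.deriv_u t ht).sub (hv.deriv_u t ht)).congr_of_mem
      (fun s hs => toL2_sub (hu.mem_left s hs).2.memLp (hv.mem_left s hs).2.memLp) ht
  · rw [Pi.sub_apply, Pi.sub_apply, hvelocity ht]
    exact ((hu.hasDerivWithinAt_trajectory ht).sub (hv.hasDerivWithinAt_trajectory ht)).congr_of_mem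
      (fun s hs => hu.trajectory_sub hv hs) ht
  · exact (hu.continuousOn_deriv_trajectory.sub hv.continuousOn_deriv_trajectory).congr
      fun t ht => hvelocity ht

lemma norm_trajectory (ha : IsCoefficient a) (hu : IsClassicalSolution a u ut) {t : ℝ}
    (ht : 0 ≤ t) : ‖trajectory a u ut t‖ = ‖trajectory a u ut 0‖ := by
  have hderiv {s : ℝ} (hs : 0 ≤ s) :
      HasDerivWithinAt (fun s => ‖trajectory a u ut s‖ ^ 2) 0 (Ici 0) s := by
    refine (hu.hasDerivWithinAt_trajectory hs).norm_sq.congr_deriv ?_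
    obtain ⟨p, hp⟩ := (hu.mem_left s hs).1.exists_isFlux ha
    rw [WithLp.prod_inner_apply, real_inner_comm]
    exact mul_eq_zero_of_right 2 (hp.inner_add_inner_eq_zero ha (hu.mem_right s hs))
  rw [← sq_eq_sq₀ (norm_nonneg _) (norm_nonneg _)]
  exact constant_of_has_deriv_right_zero (f := fun s => ‖trajectory a u ut s‖ ^ 2)
    (fun s hs => (hderiv hs.1).continuousWithinAt.mono Icc_subset_Ici_self)
    (fun s hs => (hderiv hs.1).mono (Ici_subset_Ici.2 hs.1)) t ⟨ht, le_rfl⟩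

end IsClassicalSolution

/-- The normal derivative `t ↦ u_x(t,1)` as a one-sided derivative in `x`. -/
def normalTrace (u : ℝ → ℝ → ℝ) (t : ℝ) : ℝ := derivWithin (u t) (Icc 0 1) 1

namespace IsClassicalSolution

lemma normalTrace_sub (ha : IsCoefficient a) (hu : IsClassicalSolution a u ut)
    (hv : IsClassicalSolution a v vt) {t : ℝ} (ht : 0 ≤ t) :
    normalTrace (u - v) t = normalTrace u t - normalTrace v t :=
  (hu.mem_left t ht).1.derivWithin_sub_one ha (hv.mem_left t ht).1

lemma continuousOn_normalTrace (ha : IsCoefficient a) (hu : IsClassicalSolution a u ut) :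
    ContinuousOn (normalTrace u) (Ici 0) := by
  have hux : ContinuousOn (fun t => toL2 (weightedDeriv a (u t))) (Ici 0) :=
    (WithLp.continuous_fst ..).comp_continuousOn hu.continuousOn_trajectory
  refine (((continuousOn_const (c := toL2 id)).inner hu.continuousOn_utt).add
    ((continuousOn_const (c := toL2 fun x => √(a x))).inner hux)).const_smul (a 1)⁻¹ |>.congr
    fun t ht => ?_
  obtain ⟨p, hp⟩ := (hu.mem_left t ht).1.exists_isFlux ha
  exact (eq_inv_mul_iff_mul_eq₀ ha.pos_one.ne').2 (hp.mul_derivWithin_one ha)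

lemma memLp_normalTrace (ha : IsCoefficient a) (hu : IsClassicalSolution a u ut) (T : ℝ) :
    MemLp (normalTrace u) 2 (volume.restrict (Ioo 0 T)) := by
  have hcont : ContinuousOn (normalTrace u) (Icc 0 T) :=
    (hu.continuousOn_normalTrace ha).mono Icc_subset_Ici_self
  obtain ⟨C, hC⟩ := isCompact_Icc.exists_bound_of_continuousOn hcont
  exact MemLp.of_bound ((hcont.mono Ioo_subset_Icc_self).aestronglyMeasurable measurableSet_Ioo) C
    ((ae_restrict_mem measurableSet_Ioo).mono fun t ht => hC t (Ioo_subset_Icc_self ht))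

lemma hasDerivWithinAt_crossForm (ha : IsCoefficient a) (hu : IsClassicalSolution a u ut) {t : ℝ}
    (ht : 0 ≤ t) :
    HasDerivWithinAt (fun s => 2 * ha.crossForm (trajectory a u ut s))
      (a 1 * normalTrace u t ^ 2 - ha.bulkForm (trajectory a u ut t)) (Ici 0) t := by
  refine (((ha.radialMul.hasFDerivAt.comp_hasDerivWithinAt t (hu.deriv_ux t ht)).inner ℝ
    (hu.deriv_ut t ht)).const_mul 2).congr_deriv ?_
  obtain ⟨p, hp⟩ := (hu.mem_left t ht).1.exists_isFlux ha
  change 2 * (inner ℝ (ha.radialMul (toL2 (weightedDeriv a (u t)))) (toL2 (degenOp a (u t))) +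
      inner ℝ (ha.radialMul (toL2 (weightedDeriv a (ut t)))) (toL2 (ut t))) =
    a 1 * derivWithin (u t) (Icc 0 1) 1 ^ 2 - (‖toL2 (ut t)‖ ^ 2 +
      inner ℝ (ha.defectMul (toL2 (weightedDeriv a (u t)))) (toL2 (weightedDeriv a (u t))))
  linarith [hp.two_mul_inner_radialMul ha, (hu.mem_right t ht).two_mul_inner_radialMul_self ha]

lemma mul_integral_normalTrace_sq (ha : IsCoefficient a) (hu : IsClassicalSolution a u ut) {T : ℝ}
    (hT : 0 ≤ T) :
    a 1 * (∫ t in (0 : ℝ)..T, normalTrace u t ^ 2) =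
      ha.multiplierForm (trajectory a u ut) T := by
  have hsub : uIcc 0 T ⊆ Ici 0 := uIcc_of_le hT ▸ Icc_subset_Ici_self
  have htrace : IntervalIntegrable (fun t => a 1 * normalTrace u t ^ 2) volume 0 T :=
    ((((hu.continuousOn_normalTrace ha).mono hsub).pow 2).const_smul (a 1)).intervalIntegrable
  have hbulk : IntervalIntegrable (fun t => ha.bulkForm (trajectory a u ut t)) volume 0 T :=
    (ha.continuous_bulkForm.comp_continuousOn
      (hu.continuousOn_trajectory.mono hsub)).intervalIntegrable
  have hftc := intervalIntegral.integral_eq_sub_of_hasDeriv_right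
    (fun t ht => (hu.hasDerivWithinAt_crossForm ha (hsub ht)).continuousWithinAt.mono hsub)
    (fun t ht => by
      rw [min_eq_left hT] at ht
      exact (hu.hasDerivWithinAt_crossForm ha ht.1.le).mono (Ioi_subset_Ici ht.1.le))
    (htrace.sub hbulk)
  rw [intervalIntegral.integral_sub htrace hbulk, intervalIntegral.integral_const_mul] at hftc
  rw [IsCoefficient.multiplierForm]
  linarith

end IsClassicalSolution

end ClassicalSolutions

section MildSolutions

variable {u ut w z : ℝ → ℝ → ℝ}

namespace IsMildSolution

lemma continuousOn_trajectory (hu : IsMildSolution a u ut) :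
    ContinuousOn (trajectory a u ut) (Ici 0) :=
  (WithLp.prod_continuous_toLp 2 L2 L2).comp_continuousOn
    (hu.continuousOn_ux.prodMk hu.continuousOn_ut)

lemma hasDerivWithinAt_integral_trajectory (hu : IsMildSolution a u ut) {t : ℝ} (ht : 0 ≤ t) :
    HasDerivWithinAt (fun t => ∫ s in (0 : ℝ)..t, trajectory a u ut s) (trajectory a u ut t)
      (Ici 0) t :=
  hasDerivWithinAt_Ici_intervalIntegral hu.continuousOn_trajectory ht

end IsMildSolution

/-- `(w, z)` represents the time primitive `t ↦ ∫₀ᵗ U(s) ds` of `U = (u, ut)`, which takes values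
in `D(A)` and satisfies `A (w, z) = U - U(0)`. -/
structure IsTimePrimitive (a : ℝ → ℝ) (u ut w z : ℝ → ℝ → ℝ) : Prop where
  toL2_left : ∀ t, 0 ≤ t → toL2 (w t) = ∫ s in (0 : ℝ)..t, toL2 (u s)
  toL2_right : ∀ t, 0 ≤ t → toL2 (z t) = ∫ s in (0 : ℝ)..t, toL2 (ut s)
  waveOp : ∀ t, 0 ≤ t → WaveOp a (w t) (z t) (u t - u 0) (ut t - ut 0)

lemma IsMildSolution.exists_isTimePrimitive (hu : IsMildSolution a u ut) :
    ∃ w z, IsTimePrimitive a u ut w z := by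
  choose! w z hw hz hwz using hu.integrated
  exact ⟨w, z, hw, hz, hwz⟩

namespace IsTimePrimitive

lemma energyState_eq_integral (ha : IsCoefficient a) (hw : IsTimePrimitive a u ut w z)
    (hu : IsMildSolution a u ut) {t : ℝ} (ht : 0 ≤ t) :
    energyState a (w t) (z t) = ∫ s in (0 : ℝ)..t, trajectory a u ut s := by
  have hint : IntervalIntegrable (trajectory a u ut) volume 0 t :=
    (hu.continuousOn_trajectory.mono (uIcc_of_le ht ▸ Icc_subset_Ici_self)).intervalIntegrable
  refine EnergyState.ext ?_ ?_
  · exact (MemV1.toL2_weightedDeriv_eq_integral ha ht (fun s hs => (hu.mem_left s hs).toMemV1)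
      hu.continuousOn_u hu.continuousOn_ux (hw.waveOp t ht).mem_left.2.toMemV1
      (hw.toL2_left t ht)).trans
        ((WithLp.fstL 2 ℝ L2 L2).intervalIntegral_comp_comm hint)
  · exact (hw.toL2_right t ht).trans
      ((WithLp.sndL 2 ℝ L2 L2).intervalIntegral_comp_comm hint)

lemma energyState_degenOp (ha : IsCoefficient a) (hw : IsTimePrimitive a u ut w z)
    (hu : IsMildSolution a u ut) {t : ℝ} (ht : 0 ≤ t) :
    energyState a (z t) (degenOp a (w t)) = trajectory a u ut t - trajectory a u ut 0 := by
  have hu₀ := (hu.mem_left 0 le_rfl).toMemV1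
  have hut := (hu.mem_left t ht).toMemV1
  have hwt := hw.waveOp t ht
  calc energyState a (z t) (degenOp a (w t)) = energyState a (u t - u 0) (ut t - ut 0) :=
        EnergyState.ext
          (hwt.mem_right.toMemV1.toL2_weightedDeriv_congr ha (hut.sub hu₀)
            (toL2_congr hwt.eq_left).symm)
          (toL2_congr hwt.eq_right).symm
    _ = trajectory a u ut t - trajectory a u ut 0 :=
        energyState_sub hut hu₀ (hu.mem_right t ht) (hu.mem_right 0 le_rfl)

lemma trajectory_diffQuot (ha : IsCoefficient a) (hw : IsTimePrimitive a u ut w z)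
    (hu : IsMildSolution a u ut) {h t : ℝ} (hh : 0 ≤ h) (ht : 0 ≤ t) :
    trajectory a (diffQuot h w) (diffQuot h z) t =
      diffQuot h (fun t => ∫ s in (0 : ℝ)..t, trajectory a u ut s) t := by
  have hwt := hw.waveOp t ht
  have hwt' := hw.waveOp (t + h) (add_nonneg ht hh)
  rw [trajectory, energyState_diffQuot hwt.mem_left.2.toMemV1 hwt'.mem_left.2.toMemV1
    hwt.mem_right.memLp hwt'.mem_right.memLp, diffQuot, hw.energyState_eq_integral ha hu ht,
    hw.energyState_eq_integral ha hu (add_nonneg ht hh), diffQuot]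

lemma energyState_degenOp_diffQuot (ha : IsCoefficient a) (hw : IsTimePrimitive a u ut w z)
    (hu : IsMildSolution a u ut) {h t : ℝ} (hh : 0 ≤ h) (ht : 0 ≤ t) :
    energyState a (diffQuot h z t) (degenOp a (diffQuot h w t)) =
      diffQuot h (trajectory a u ut) t := by
  have hwt := hw.waveOp t ht
  have hwt' := hw.waveOp (t + h) (add_nonneg ht hh)
  have hsub : energyState a (z (t + h) - z t) (degenOp a (w (t + h) - w t)) =
      energyState a (z (t + h)) (degenOp a (w (t + h))) - energyState a (z t) (degenOp a (w t)) :=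
    EnergyState.ext (hwt'.mem_right.toMemV1.toL2_weightedDeriv_sub hwt.mem_right.toMemV1)
      (hwt'.mem_left.1.toL2_degenOp_sub ha hwt.mem_left.1)
  rw [diffQuot, diffQuot, degenOp_const_smul,
    energyState_const_smul _ (hwt'.mem_right.sub hwt.mem_right).toMemV1
      ((hwt'.mem_left.1.sub ha hwt.mem_left.1).memLp_degenOp ha),
    hsub, hw.energyState_degenOp ha hu ht, hw.energyState_degenOp ha hu (add_nonneg ht hh),
    sub_sub_sub_cancel_right, diffQuot]

lemma toL2_diffQuot_left (hw : IsTimePrimitive a u ut w z) {h t : ℝ} (hh : 0 ≤ h) (ht : 0 ≤ t) :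
    toL2 (diffQuot h w t) = diffQuot h (fun t => ∫ s in (0 : ℝ)..t, toL2 (u s)) t := by
  have hth := add_nonneg ht hh
  have hwt := (hw.waveOp t ht).mem_left.2.memLp
  have hwt' := (hw.waveOp (t + h) hth).mem_left.2.memLp
  rw [diffQuot, toL2_const_smul _ (hwt'.sub hwt), toL2_sub hwt' hwt, hw.toL2_left t ht,
    hw.toL2_left _ hth, diffQuot]

lemma toL2_diffQuot_right (hw : IsTimePrimitive a u ut w z) (hu : IsMildSolution a u ut)
    {h t : ℝ} (hh : 0 ≤ h) (ht : 0 ≤ t) :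
    toL2 (diffQuot h z t) = diffQuot h (fun t => toL2 (u t)) t := by
  have hincrement {s : ℝ} (hs : 0 ≤ s) : toL2 (z s) = toL2 (u s) - toL2 (u 0) := by
    rw [← toL2_sub (hu.mem_left s hs).memLp (hu.mem_left 0 le_rfl).memLp]
    exact (toL2_congr (hw.waveOp s hs).eq_left).symm
  have hth := add_nonneg ht hh
  have hzt := (hw.waveOp t ht).mem_right.memLp
  have hzt' := (hw.waveOp (t + h) hth).mem_right.memLp
  rw [diffQuot, toL2_const_smul _ (hzt'.sub hzt), toL2_sub hzt' hzt, hincrement ht,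
    hincrement hth, sub_sub_sub_cancel_right, diffQuot]

lemma isClassicalSolution_diffQuot (ha : IsCoefficient a) (hw : IsTimePrimitive a u ut w z)
    (hu : IsMildSolution a u ut) {h : ℝ} (hh : 0 ≤ h) :
    IsClassicalSolution a (diffQuot h w) (diffQuot h z) := by
  have hwave {t : ℝ} (ht : 0 ≤ t) := hw.waveOp (t + h) (add_nonneg ht hh)
  refine .of_hasDerivWithinAt_trajectory
    (fun t ht => ((hwave ht).mem_left.sub ha (hw.waveOp t ht).mem_left).const_smul _)
    (fun t ht => ((hwave ht).mem_right.sub (hw.waveOp t ht).mem_right).const_smul _)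
    (fun t ht => ?_) (fun t ht => ?_) ?_
  · rw [hw.toL2_diffQuot_right hu hh ht]
    exact (hasDerivWithinAt_diffQuot hh
      (fun s hs => hasDerivWithinAt_Ici_intervalIntegral hu.continuousOn_u hs) ht).congr_of_mem
        (fun s hs => hw.toL2_diffQuot_left hh hs) ht
  · rw [hw.energyState_degenOp_diffQuot ha hu hh ht]
    exact (hasDerivWithinAt_diffQuot hh
      (fun s hs => hu.hasDerivWithinAt_integral_trajectory hs) ht).congr_of_mem
        (fun s hs => hw.trajectory_diffQuot ha hu hh hs) ht
  · exact (continuousOn_diffQuot hh hu.continuousOn_trajectory).congr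
      fun t ht => hw.energyState_degenOp_diffQuot ha hu hh ht

lemma tendsto_trajectory_diffQuot (ha : IsCoefficient a) (hw : IsTimePrimitive a u ut w z)
    (hu : IsMildSolution a u ut) {t : ℝ} (ht : 0 ≤ t) :
    Tendsto (fun h => trajectory a (diffQuot h w) (diffQuot h z) t) (𝓝[>] 0)
      (𝓝 (trajectory a u ut t)) := by
  refine (tendsto_diffQuot ((hu.hasDerivWithinAt_integral_trajectory ht).mono
    (Ici_subset_Ici.2 ht))).congr' ?_
  filter_upwards [self_mem_nhdsWithin] with h hh
  exact (hw.trajectory_diffQuot ha hu (le_of_lt hh) ht).symm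

end IsTimePrimitive

section Approximation

variable {un utn : ℕ → ℝ → ℝ → ℝ}

lemma IsMildSolution.exists_tendsto_trajectory (ha : IsCoefficient a)
    (hu : IsMildSolution a u ut) :
    ∃ un utn : ℕ → ℝ → ℝ → ℝ, (∀ n, IsClassicalSolution a (un n) (utn n)) ∧
      ∀ t, 0 ≤ t → Tendsto (fun n => trajectory a (un n) (utn n) t) atTop
        (𝓝 (trajectory a u ut t)) := by
  obtain ⟨w, z, hw⟩ := hu.exists_isTimePrimitive
  obtain ⟨h, -, hpos, hlim⟩ := exists_seq_strictAnti_tendsto' (zero_lt_one' ℝ)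
  have hlim' : Tendsto h atTop (𝓝[>] 0) :=
    tendsto_nhdsWithin_iff.2 ⟨hlim, .of_forall fun n => (hpos n).1⟩
  exact ⟨fun n => diffQuot (h n) w, fun n => diffQuot (h n) z,
    fun n => hw.isClassicalSolution_diffQuot ha hu (hpos n).1.le,
    fun t ht => (hw.tendsto_trajectory_diffQuot ha hu ht).comp hlim'⟩

lemma isClassicalApproximation_iff (hun : ∀ n, IsClassicalSolution a (un n) (utn n)) :
    IsClassicalApproximation a un utn u ut ↔
      Tendsto (fun n => trajectory a (un n) (utn n) 0) atTop (𝓝 (trajectory a u ut 0)) := by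
  refine ⟨fun h => ?_, fun h => ⟨hun, ?_, ?_⟩⟩
  · exact ((WithLp.prod_continuous_toLp 2 L2 L2).tendsto _).comp
      (h.tendsto_ux.prodMk_nhds h.tendsto_ut)
  · exact ((WithLp.continuous_fst ..).tendsto _).comp h
  · exact ((WithLp.continuous_snd ..).tendsto _).comp h

lemma IsMildSolution.exists_isClassicalApproximation (ha : IsCoefficient a)
    (hu : IsMildSolution a u ut) : ∃ un utn, IsClassicalApproximation a un utn u ut :=
  let ⟨un, utn, hun, hlim⟩ := hu.exists_tendsto_trajectory ha
  ⟨un, utn, (isClassicalApproximation_iff hun).2 (hlim 0 le_rfl)⟩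

lemma IsMildSolution.norm_trajectory (ha : IsCoefficient a) (hu : IsMildSolution a u ut) {t : ℝ}
    (ht : 0 ≤ t) : ‖trajectory a u ut t‖ = ‖trajectory a u ut 0‖ := by
  obtain ⟨un, utn, hun, hlim⟩ := hu.exists_tendsto_trajectory ha
  exact tendsto_nhds_unique
    ((hlim t ht).norm.congr fun n => (hun n).norm_trajectory ha ht) (hlim 0 le_rfl).norm

lemma IsMildSolution.dist_trajectory (ha : IsCoefficient a) (hu : IsMildSolution a u ut)
    {v vt : ℝ → ℝ → ℝ} (hv : IsClassicalSolution a v vt) {t : ℝ} (ht : 0 ≤ t) :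
    dist (trajectory a v vt t) (trajectory a u ut t) =
      dist (trajectory a v vt 0) (trajectory a u ut 0) := by
  obtain ⟨un, utn, hun, hlim⟩ := hu.exists_tendsto_trajectory ha
  refine tendsto_nhds_unique ((tendsto_const_nhds.dist (hlim t ht)).congr fun n => ?_)
    (tendsto_const_nhds.dist (hlim 0 le_rfl))
  rw [dist_eq_norm, dist_eq_norm, ← hv.trajectory_sub (hun n) ht,
    ← hv.trajectory_sub (hun n) le_rfl, (hv.sub ha (hun n)).norm_trajectory ha ht]

lemma IsClassicalApproximation.tendsto_trajectory (ha : IsCoefficient a)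
    (h : IsClassicalApproximation a un utn u ut) (hu : IsMildSolution a u ut) {t : ℝ}
    (ht : 0 ≤ t) :
    Tendsto (fun n => trajectory a (un n) (utn n) t) atTop (𝓝 (trajectory a u ut t)) :=
  tendsto_iff_dist_tendsto_zero.2 <|
    (tendsto_iff_dist_tendsto_zero.1 ((isClassicalApproximation_iff h.classical).1 h)).congr
      fun n => (hu.dist_trajectory ha (h.classical n) ht).symm

end Approximation

end MildSolutions

section NormalDerivative

open scoped NNReal

variable {u ut v vt : ℝ → ℝ → ℝ} {γ : ℝ → ℝ} {T : ℝ}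

/-- The constant in the `L²(0,T)` bound of the normal derivative by the norm of the initial state:
its square is the constant of `IsCoefficient.multiplierForm_le`, divided by `a 1`. -/
def traceConst (a : ℝ → ℝ) (T : ℝ) : ℝ≥0 := (√((3 * T + 2 / √(a 1)) / a 1)).toNNReal

lemma IsClassicalSolution.eLpNorm_normalTrace_le (ha : IsCoefficient a)
    (hu : IsClassicalSolution a u ut) (hT : 0 ≤ T) :
    eLpNorm (normalTrace u) 2 (volume.restrict (Ioo 0 T)) ≤
      traceConst a T * ‖trajectory a u ut 0‖ₑ := by
  have hpos := ha.pos_one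
  have hconst : 0 ≤ (3 * T + 2 / √(a 1)) / a 1 := by positivity
  have hle : a 1 * (∫ t in Ioo 0 T, normalTrace u t ^ 2) ≤
      (3 * T + 2 / √(a 1)) * ‖trajectory a u ut 0‖ ^ 2 := by
    rw [← integral_Ioc_eq_integral_Ioo, ← intervalIntegral.integral_of_le hT,
      hu.mul_integral_normalTrace_sq ha hT]
    exact ha.multiplierForm_le (U := trajectory a u ut) (fun _ ht => hu.norm_trajectory ha ht) hT
  refine (eLpNorm_two_le_ofReal (hu.memLp_normalTrace ha T)
    (B := √((3 * T + 2 / √(a 1)) / a 1) * ‖trajectory a u ut 0‖) (by positivity) ?_).trans_eq ?_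
  · rwa [mul_pow, Real.sq_sqrt hconst, div_mul_eq_mul_div, le_div_iff₀' hpos]
  · rw [ENNReal.ofReal_mul (Real.sqrt_nonneg _), ofReal_norm, traceConst]
    rfl

lemma IsClassicalSolution.eLpNorm_normalTrace_sub_le (ha : IsCoefficient a)
    (hu : IsClassicalSolution a u ut) (hv : IsClassicalSolution a v vt) (hT : 0 ≤ T) :
    eLpNorm (normalTrace u - normalTrace v) 2 (volume.restrict (Ioo 0 T)) ≤
      traceConst a T * edist (trajectory a u ut 0) (trajectory a v vt 0) := by
  rw [edist_eq_enorm_sub, ← hu.trajectory_sub hv le_rfl]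
  refine (eLpNorm_congr_ae ?_).trans_le ((hu.sub ha hv).eLpNorm_normalTrace_le ha hT)
  filter_upwards [ae_restrict_mem measurableSet_Ioo] with t ht
  exact (hu.normalTrace_sub ha hv ht.1.le).symm

lemma iUnion_Ioo_zero_natCast : ⋃ k : ℕ, Ioo (0 : ℝ) k = Ioi 0 := by
  ext t
  simpa only [mem_iUnion, mem_Ioo, mem_Ioi, exists_and_left, and_iff_left_iff_imp] using
    fun _ => exists_nat_gt t

lemma IsMildSolution.exists_isNormalDerivative (ha : IsCoefficient a)
    (hu : IsMildSolution a u ut) : ∃ γ, IsNormalDerivative a u ut γ := by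
  obtain ⟨un, utn, hun⟩ := hu.exists_isClassicalApproximation ha
  let ι := {p : (ℝ → ℝ → ℝ) × (ℝ → ℝ → ℝ) // IsClassicalSolution a p.1 p.2}
  have hclosure : trajectory a u ut 0 ∈ closure (range fun p : ι => trajectory a p.1.1 p.1.2 0) :=
    mem_closure_of_tendsto ((isClassicalApproximation_iff hun.classical).1 hun)
      (.of_forall fun n => ⟨⟨(un n, utn n), hun.classical n⟩, rfl⟩)
  obtain ⟨γ, hγ, hlim⟩ := exists_tendsto_eLpNorm_of_mem_closure_range (p := 2) one_le_two
    (μ := volume) (s := fun k : ℕ => Ioo (0 : ℝ) k) (Φ := fun p : ι => normalTrace p.1.1)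
    (iUnion_Ioo_zero_natCast ▸ fun p => ((p.2.continuousOn_normalTrace ha).mono
      Ioi_subset_Ici_self).aestronglyMeasurable measurableSet_Ioi)
    (fun k p q => p.2.eLpNorm_normalTrace_sub_le ha q.2 k.cast_nonneg) hclosure
  refine ⟨γ, iUnion_Ioo_zero_natCast ▸ hγ, ⟨un, utn, hun⟩, fun vn vtn hvn T _ => ?_⟩
  have hlim' := hlim (fun n => ⟨(vn n, vtn n), hvn.classical n⟩)
    ((isClassicalApproximation_iff hvn.classical).1 hvn) ⌈T⌉₊
  exact tendsto_of_tendsto_of_tendsto_of_le_of_le tendsto_const_nhds hlim' (fun _ => zero_le)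
    fun n => eLpNorm_mono_measure _
      (Measure.restrict_mono_set _ (Ioo_subset_Ioo_right (Nat.le_ceil T)))

namespace IsNormalDerivative

lemma memLp (ha : IsCoefficient a) (hγ : IsNormalDerivative a u ut γ) (hT : 0 ≤ T) :
    MemLp γ 2 (volume.restrict (Ioo 0 T)) := by
  obtain ⟨un, utn, hun⟩ := hγ.exists_approximation
  exact Lp.memLp_of_cauchy_tendsto one_le_two
    (fun n => (hun.classical n).memLp_normalTrace ha T) γ
    (hγ.aestronglyMeasurable.mono_set Ioo_subset_Ioi_self) (hγ.tendsto un utn hun T hT)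

lemma mul_integral_sq (ha : IsCoefficient a) (hγ : IsNormalDerivative a u ut γ)
    (hu : IsMildSolution a u ut) (hT : 0 ≤ T) :
    a 1 * (∫ t in (0 : ℝ)..T, γ t ^ 2) = ha.multiplierForm (trajectory a u ut) T := by
  obtain ⟨un, utn, hun⟩ := hγ.exists_approximation
  have htrace : Tendsto (fun n => ∫ t in (0 : ℝ)..T, normalTrace (un n) t ^ 2) atTop
      (𝓝 (∫ t in (0 : ℝ)..T, γ t ^ 2)) := by
    simp only [intervalIntegral.integral_of_le hT, integral_Ioc_eq_integral_Ioo]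
    exact tendsto_integral_sq_of_tendsto_eLpNorm
      (fun n => (hun.classical n).memLp_normalTrace ha T) (hγ.memLp ha hT)
      (hγ.tendsto un utn hun T hT)
  have hform : Tendsto (fun n => ha.multiplierForm (trajectory a (un n) (utn n)) T) atTop
      (𝓝 (ha.multiplierForm (trajectory a u ut) T)) :=
    ha.tendsto_multiplierForm (fun n => (hun.classical n).continuousOn_trajectory)
      (fun n t ht => (hun.classical n).norm_trajectory ha ht)
      (fun t ht => hun.tendsto_trajectory ha hu ht) hT
  exact tendsto_nhds_unique (htrace.const_mul (a 1)) <|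
    hform.congr fun n => ((hun.classical n).mul_integral_normalTrace_sq ha hT).symm

end IsNormalDerivative

lemma IsCoefficient.one_div_sqrt_le (ha : IsCoefficient a) : 1 / √(a 1) ≤ 1 / min 1 (a 1) := by
  have hpos := ha.pos_one
  refine one_div_le_one_div_of_le (lt_min one_pos hpos) (Real.le_sqrt_of_sq_le ?_)
  calc min 1 (a 1) ^ 2 = min 1 (a 1) * min 1 (a 1) := sq _
    _ ≤ 1 * a 1 := mul_le_mul (min_le_left _ _) (min_le_right _ _)
        (le_min zero_le_one hpos.le) zero_le_one
    _ = a 1 := one_mul _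

namespace IsMildSolution

lemma two_mul_energy (ha : IsCoefficient a) (hu : IsMildSolution a u ut) {t : ℝ} (ht : 0 ≤ t) :
    2 * energy a u ut t = ‖trajectory a u ut t‖ ^ 2 := by
  have hux := (hu.mem_left t ht).toMemV1
  have hut := hu.mem_right t ht
  have hsq : ∫ x in (0 : ℝ)..1, (ut t x ^ 2 + a x * deriv (u t) x ^ 2) =
      ∫ x, (weightedDeriv a (u t) x ^ 2 + ut t x ^ 2) ∂unitMeasure := by
    rw [intervalIntegral.integral_of_le zero_le_one, integral_Ioc_eq_integral_Ioo]
    refine setIntegral_congr_fun measurableSet_Ioo fun x hx => ?_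
    rw [weightedDeriv_sq ha _ hx, add_comm]
  rw [trajectory, norm_energyState_sq hux hut, energy, hsq,
    integral_add hux.memLp_weightedDeriv.integrable_sq hut.integrable_sq]
  ring

lemma multiplierForm_le (ha : IsCoefficient a) (hu : IsMildSolution a u ut) (hT : 0 ≤ T) :
    ha.multiplierForm (trajectory a u ut) T ≤ (6 * T + 4 / min 1 (a 1)) * energy a u ut 0 :=
  calc ha.multiplierForm (trajectory a u ut) T
      ≤ (3 * T + 2 / √(a 1)) * ‖trajectory a u ut 0‖ ^ 2 :=
        ha.multiplierForm_le (U := trajectory a u ut) (fun _ ht => hu.norm_trajectory ha ht) hT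
    _ = (3 * T + 2 * (1 / √(a 1))) * ‖trajectory a u ut 0‖ ^ 2 := by ring
    _ ≤ (3 * T + 2 * (1 / min 1 (a 1))) * ‖trajectory a u ut 0‖ ^ 2 := by
        gcongr (_ + _ * ?_) * _
        exact ha.one_div_sqrt_le
    _ = (6 * T + 4 / min 1 (a 1)) * energy a u ut 0 := by
        rw [← hu.two_mul_energy ha le_rfl]
        ring

lemma multiplierForm_trajectory (ha : IsCoefficient a) (hu : IsMildSolution a u ut)
    (hT : 0 ≤ T) :
    ha.multiplierForm (trajectory a u ut) T =
      (∫ t in (0 : ℝ)..T, ∫ x in (0 : ℝ)..1,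
        (ut t x ^ 2 + (a x - x * coeffDeriv a x) * deriv (u t) x ^ 2)) +
      2 * ((∫ x in (0 : ℝ)..1, x * deriv (u T) x * ut T x) -
        ∫ x in (0 : ℝ)..1, x * deriv (u 0) x * ut 0 x) := by
  have hcross {t : ℝ} (ht : 0 ≤ t) : ha.crossForm (trajectory a u ut t) =
      ∫ x in (0 : ℝ)..1, x * deriv (u t) x * ut t x :=
    (hu.mem_left t ht).toMemV1.crossForm_energyState ha (hu.mem_right t ht)
  rw [IsCoefficient.multiplierForm, hcross hT, hcross le_rfl]
  congr 1
  refine intervalIntegral.integral_congr fun t ht => ?_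
  rw [uIcc_of_le hT] at ht
  exact (hu.mem_left t ht.1).toMemV1.bulkForm_energyState ha (hu.mem_right t ht.1)

end IsMildSolution

end NormalDerivative

end DegenerateWave

end

theorem mainTheorem2 (a : ℝ → ℝ) (ha : DegenerateWave.IsCoefficient a)
    (u ut : ℝ → ℝ → ℝ) (hu : DegenerateWave.IsMildSolution a u ut) :
    (∃ γ : ℝ → ℝ, DegenerateWave.IsNormalDerivative a u ut γ) ∧
    ∀ γ : ℝ → ℝ, DegenerateWave.IsNormalDerivative a u ut γ → ∀ T : ℝ, 0 ≤ T →
      MemLp γ 2 (volume.restrict (Ioo 0 T)) ∧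
      a 1 * (∫ t in (0 : ℝ)..T, γ t ^ 2) ≤
        (6 * T + 4 / min 1 (a 1)) * DegenerateWave.energy a u ut 0 ∧
      a 1 * (∫ t in (0 : ℝ)..T, γ t ^ 2) =
        (∫ t in (0 : ℝ)..T, ∫ x in (0 : ℝ)..1,
          (ut t x ^ 2 + (a x - x * DegenerateWave.coeffDeriv a x) * deriv (u t) x ^ 2)) +
        2 * ((∫ x in (0 : ℝ)..1, x * deriv (u T) x * ut T x) -
          ∫ x in (0 : ℝ)..1, x * deriv (u 0) x * ut 0 x) := by
  refine ⟨hu.exists_isNormalDerivative ha, fun γ hγ T hT => ⟨hγ.memLp ha hT, ?_, ?_⟩⟩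
  · exact (hγ.mul_integral_sq ha hu hT).trans_le (hu.multiplierForm_le ha hT)
  · exact (hγ.mul_integral_sq ha hu hT).trans (hu.multiplierForm_trajectory ha hT)
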